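/- Let $\mathbb K$ be a commutative ring containing $\mathbb Q$ and let $\Lambda=\mathbb K[p_1,p_2,\dots]$ be the ring of symmetric functions over $\mathbb K$, with Schur functions $s_\lambda$, with the Hall inner product (the $\mathbb K$-bilinear form with $\langle s_\lambda,s_\mu\rangle=\delta_{\lambda\mu}$), and with the standard involution $\omega$, the algebra homomorphism with $\omega(p_k)=(-1)^{k+1}p_k$. For $f,g\in\Lambda$ let $f^\perp g=\sum_\mu\langle g,f s_\mu\rangle s_\mu$ (the adjoint of multiplication by $f$). For $f\in\Lambda$ and $g\in\mathbb Q[p_1,p_2,\dots]$ let $f[g]$ be the plethysm: $p_r[g]$ is obtained from $g$ by replacing every $p_k$ with $p_{rk}$, and $f[g]$ is obtained from $f$ by replacing every $p_r$ with $p_r[g]$. Let $\lambda$ and $\mu$ be partitions (possibly empty), let $r$ be a positive integer, and let $r'=\min(r,\ell(\mu))$, where $\ell(\mu)$ is the number of parts of $\mu$. Then $$s_{1^r}^\perp\bigl(s_\lambda[s_\mu]\bigr)=\sum_{(\nu^{(0)},\dots,\nu^{(r')})}\bigl\langle s_\lambda,\;s_{\nu^{(0)}}s_{\nu^{(1)}}\cdots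 s_{\nu^{(r')}}\bigr\rangle\; s_{\nu^{(0)}}[s_\mu]\;\prod_{i=1}^{r'}\bigl(\omega^{i}s_{\nu^{(i)}}\bigr)\bigl[s_{1^i}^\perp s_\mu\bigr],$$ where the sum is over all sequences of partitions $(\nu^{(0)},\nu^{(1)},\dots,\nu^{(r')})$ with $\sum_{i=0}^{r'}|\nu^{(i)}|=|\lambda|$ and $\sum_{i=0}^{r'}i\,|\nu^{(i)}|=r$. Moreover, for every partition $\nu$ and every $i\ge 0$, $\omega^{i}s_{\nu}=s_{\nu}$ if $i$ is even and $\omega^{i}s_{\nu}=s_{\nu'}$ (with $\nu'$ the conjugate partition) if $i$ is odd. -/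

import Mathlib

namespace SymFun

open MvPolynomial

/-- The ring of symmetric functions `Λ = K[p₁, p₂, p₃, …]`; the variable `X k` is the power
sum `p_k`. -/
abbrev Sym (K : Type*) [CommRing K] : Type _ := MvPolynomial ℕ+ K

/-- The complete homogeneous symmetric functions, through `n h_n = ∑_{i=1}^{n} p_i h_{n-i}`. -/
noncomputable def complete (K : Type*) [CommRing K] [Algebra ℚ K] : ℕ → Sym K
  | 0 => 1
  | n + 1 => ((n + 1 : ℚ)⁻¹) •
      ∑ i : Fin (n + 1), (X (Nat.succPNat i) : Sym K) * complete K (n - i)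

/-- The complete symmetric functions with integer index: `h_k = 0` for `k < 0`. -/
noncomputable def completeInt (K : Type*) [CommRing K] [Algebra ℚ K] (k : ℤ) : Sym K :=
  if 0 ≤ k then complete K k.toNat else 0

/-- The Schur function `s_l = det (h_{l_i - i + j})`, where `i, j` range over the rows
of `l`. It is the generating function of the semistandard tableaux of shape `l`: see `inVars_schur`.
A partition is a Young diagram: `rowLen i` is its part number `i` (counted from 0), `colLen 0` its
length and `card` its size. -/
noncomputable def schur (K : Type*) [CommRing K] [Algebra ℚ K] (l : YoungDiagram) : Sym K :=
  Matrix.det (Matrix.of fun i j : Fin (l.colLen 0) =>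
    completeInt K ((l.rowLen i : ℤ) - (i : ℤ) + (j : ℤ)))

/-! ### The complete symmetric functions generate freely -/

section Generators

variable (K : Type*) [CommRing K] [Algebra ℚ K]

theorem complete_zero : complete K 0 = 1 := by rw [complete]

theorem complete_succ (n : ℕ) : ((n + 1 : ℚ)) • complete K (n + 1) =
    ∑ i ∈ Finset.range (n + 1), (X (Nat.succPNat i) : Sym K) * complete K (n - i) := by
  rw [complete, smul_smul, mul_inv_cancel₀ (by positivity), one_smul, Finset.sum_range]

/-- The power sums as polynomials in the complete symmetric functions (the variables). -/
noncomputable def powerIn : ℕ → Sym K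
  | 0 => 0
  | n + 1 => ((n + 1 : ℚ)) • (X (Nat.succPNat n) : Sym K) -
      ∑ i : Fin n, powerIn (i + 1) * X (Nat.toPNat' (n - i))

theorem powerIn_succ (n : ℕ) : powerIn K (n + 1) = ((n + 1 : ℚ)) • (X (Nat.succPNat n) : Sym K) -
      ∑ i ∈ Finset.range n, powerIn K (i + 1) * X (Nat.toPNat' (n - i)) := by
  rw [powerIn, Finset.sum_range]

noncomputable def toComplete : Sym K →ₐ[K] Sym K := aeval fun k : ℕ+ => complete K k
noncomputable def ofComplete : Sym K →ₐ[K] Sym K := aeval fun k : ℕ+ => powerIn K k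

theorem algHom_qsmul (φ : Sym K →ₐ[K] Sym K) (c : ℚ) (x : Sym K) : φ (c • x) = c • φ x :=
  map_rat_smul φ c x

theorem toComplete_powerIn (n : ℕ) : toComplete K (powerIn K (n + 1)) = X (Nat.succPNat n) := by
  induction n using Nat.strong_induction_on with
  | _ n ih =>
    rw [powerIn_succ, map_sub, map_sum, algHom_qsmul]
    have h1 : toComplete K (X (Nat.succPNat n)) = complete K (n + 1) := by simp [toComplete]
    rw [h1, complete_succ, Finset.sum_range_succ]
    have : ∀ i ∈ Finset.range n, toComplete K (powerIn K (i + 1) * X (Nat.toPNat' (n - i))) =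
        X (Nat.succPNat i) * complete K (n - i) := by
      intro i hi
      have hi' := Finset.mem_range.1 hi
      rw [map_mul, ih i hi']
      simp [toComplete, Nat.toPNat'_coe, hi']
    rw [Finset.sum_congr rfl this]
    simp [complete_zero]

theorem ofComplete_complete (n : ℕ) :
    ofComplete K (complete K (n + 1)) = X (Nat.succPNat n) := by
  induction n using Nat.strong_induction_on with
  | _ n ih =>
    have h0 : ((n + 1 : ℚ)) ≠ 0 := by positivity
    have key : ((n + 1 : ℚ)) • ofComplete K (complete K (n + 1)) =
        ((n + 1 : ℚ)) • (X (Nat.succPNat n) : Sym K) := by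
      rw [← algHom_qsmul, complete_succ, map_sum, Finset.sum_range_succ]
      have : ∀ i ∈ Finset.range n, ofComplete K (X (Nat.succPNat i) * complete K (n - i)) =
          powerIn K (i + 1) * X (Nat.toPNat' (n - i)) := by
        intro i hi
        have hi' := Finset.mem_range.1 hi
        obtain ⟨k, hk⟩ : ∃ k, n - i = k + 1 := ⟨n - i - 1, by omega⟩
        rw [map_mul, hk, ih k (by omega)]
        simp [ofComplete]
        rfl
      rw [Finset.sum_congr rfl this]
      have hX : ofComplete K (X (Nat.succPNat n)) = powerIn K (n + 1) := by simp [ofComplete]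
      rw [Nat.sub_self, complete_zero, mul_one, hX, powerIn_succ]
      abel
    have := congrArg (fun x => ((n + 1 : ℚ)⁻¹) • x) key
    simpa [smul_smul, inv_mul_cancel₀ h0] using this

/-- The complete symmetric functions are free polynomial generators. -/
noncomputable def completeEquiv : Sym K ≃ₐ[K] Sym K :=
  AlgEquiv.ofAlgHom (toComplete K) (ofComplete K)
    (by
      ext k : 1
      obtain ⟨n, rfl⟩ : ∃ n, k = Nat.succPNat n := ⟨k.natPred, by simp⟩
      simpa [ofComplete] using toComplete_powerIn K n)
    (by
      ext k : 1
      obtain ⟨n, rfl⟩ : ∃ n, k = Nat.succPNat n := ⟨k.natPred, by simp⟩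
      simpa [toComplete] using ofComplete_complete K n)

end Generators

/-! ### Partitions and monomials -/

/-- The exponent vector of the monomial `x_{l_1} x_{l_2} ⋯`. -/
noncomputable def expo (l : YoungDiagram) : ℕ+ →₀ ℕ :=
  Multiset.toFinsupp ((l.rowLens : Multiset ℕ).map Nat.toPNat')

theorem expo_bijective : Function.Bijective expo := by
  constructor
  · intro l l' h
    have h1 := Multiset.toFinsupp.injective h
    have h2 := congrArg (Multiset.map (fun k : ℕ+ => (k : ℕ))) h1
    have h3 : ∀ l : YoungDiagram, Multiset.map (fun k : ℕ+ => (k : ℕ))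
        ((l.rowLens : Multiset ℕ).map Nat.toPNat') = (l.rowLens : Multiset ℕ) := by
      intro l
      rw [Multiset.map_map]
      conv_rhs => rw [← Multiset.map_id (l.rowLens : Multiset ℕ)]
      refine Multiset.map_congr rfl fun x hx => ?_
      have := l.pos_of_mem_rowLens x (by simpa using hx)
      simp [Nat.toPNat'_coe, this]
    rw [h3, h3, Multiset.coe_eq_coe] at h2
    have h4 : l.rowLens = l'.rowLens :=
      h2.eq_of_pairwise (fun a b _ _ h h' => le_antisymm h' h)
        l.rowLens_sorted.pairwise l'.rowLens_sorted.pairwise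
    exact YoungDiagram.equivListRowLens.injective (Subtype.ext h4)
  · intro m
    let s : Multiset ℕ := (Multiset.toFinsupp.symm m).map (fun k : ℕ+ => (k : ℕ))
    let w : List ℕ := s.sort (· ≥ ·)
    have hw : w.SortedGE := (Multiset.pairwise_sort s (· ≥ ·)).sortedGE
    have hpos : ∀ x ∈ w, 0 < x := by
      intro x hx
      rw [Multiset.mem_sort, Multiset.mem_map] at hx
      obtain ⟨k, -, rfl⟩ := hx
      exact k.pos
    refine ⟨YoungDiagram.ofRowLens w hw, ?_⟩
    rw [expo, YoungDiagram.rowLens_ofRowLens_eq_self hpos, Multiset.sort_eq, Multiset.map_map]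
    have : (Nat.toPNat' ∘ fun k : ℕ+ => (k : ℕ)) = id := by
      ext k; simp
    rw [this, Multiset.map_id]
    simp

/-- The exponent vector of `x_n`, where `x_0 = 1`. -/
noncomputable def unitExpo (n : ℕ) : ℕ+ →₀ ℕ :=
  if 0 < n then Finsupp.single (Nat.toPNat' n) 1 else 0

theorem expo_eq_sum (l : YoungDiagram) :
    expo l = ∑ i : Fin (l.colLen 0), unitExpo (l.rowLen i) := by
  have h : ∀ s : Multiset ℕ+, Multiset.toFinsupp s =
      (s.map fun k => Finsupp.single k 1).sum := by
    intro s
    induction s using Multiset.induction_on with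
    | empty => simp
    | cons a s ih => rw [← Multiset.singleton_add, map_add, ih]; simp
  rw [expo, h, Multiset.map_map, Multiset.map_coe, Multiset.sum_coe, YoungDiagram.rowLens,
    List.map_map, ← Finset.sum_range (fun i => unitExpo (l.rowLen i)), Finset.sum_range,
    ← List.sum_ofFn, List.ofFn_eq_map]
  rw [← List.map_coe_finRange_eq_range, List.map_map]
  congr 1
  refine List.map_congr_left fun i _ => ?_
  have hi : 0 < l.rowLen i := by
    rw [← YoungDiagram.mem_iff_lt_rowLen, YoungDiagram.mem_iff_lt_colLen]; exact i.2
  simp [unitExpo, hi]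

/-- Additive statistics of exponent vectors: the weight and the sum of squares of the parts. -/
noncomputable def expoWt : (ℕ+ →₀ ℕ) →+ ℕ :=
  Finsupp.liftAddHom fun k : ℕ+ => AddMonoidHom.mulLeft (k : ℕ)
noncomputable def expoSq : (ℕ+ →₀ ℕ) →+ ℕ :=
  Finsupp.liftAddHom fun k : ℕ+ => AddMonoidHom.mulLeft ((k : ℕ) ^ 2)

theorem expoWt_unit (n : ℕ) : expoWt (unitExpo n) = n := by
  by_cases h : 0 < n
  · simp [unitExpo, expoWt, h, Nat.toPNat'_coe]
  · have : n = 0 := by omega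
    subst this; simp [unitExpo]

theorem expoSq_unit (n : ℕ) : expoSq (unitExpo n) = n ^ 2 := by
  by_cases h : 0 < n
  · simp [unitExpo, expoSq, h, Nat.toPNat'_coe]
  · have : n = 0 := by omega
    subst this; simp [unitExpo]

theorem expoSq_le (m : ℕ+ →₀ ℕ) : expoSq m ≤ expoWt m ^ 2 := by
  induction m using Finsupp.induction_linear with
  | zero => simp
  | add f g hf hg => rw [map_add, map_add]; nlinarith [Nat.zero_le (expoWt f * expoWt g)]
  | single k c =>
    simp only [expoSq, expoWt, Finsupp.liftAddHom_apply_single, AddMonoidHom.coe_mulLeft]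
    rw [mul_pow]
    exact Nat.mul_le_mul_left _ (Nat.le_self_pow (by norm_num) c)

theorem card_eq_sum (l : YoungDiagram) : l.card = ∑ i : Fin (l.colLen 0), l.rowLen i := by
  rw [← Finset.sum_range (fun i => l.rowLen i)]
  have : l.cells = (Finset.range (l.colLen 0)).biUnion fun i => l.row i := by
    ext ⟨i, j⟩
    simp only [Finset.mem_biUnion, Finset.mem_range, YoungDiagram.mem_cells,
      YoungDiagram.mem_row_iff]
    constructor
    · intro h
      exact ⟨i, YoungDiagram.mem_iff_lt_colLen.1 (l.up_left_mem le_rfl (Nat.zero_le j) h), h, rfl⟩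
    · rintro ⟨_, _, h, _⟩; exact h
  rw [YoungDiagram.card, this, Finset.card_biUnion]
  · simp [YoungDiagram.rowLen_eq_card]
  · intro i _ i' _ hne
    rw [Function.onFun, Finset.disjoint_left]
    intro c hc hc'
    exact hne ((YoungDiagram.mem_row_iff.1 hc).2.symm.trans (YoungDiagram.mem_row_iff.1 hc').2)

theorem expoWt_expo (l : YoungDiagram) : expoWt (expo l) = l.card := by
  rw [expo_eq_sum, map_sum, card_eq_sum]; simp [expoWt_unit]


/-! ### Triangularity and the Schur basis -/

section Triangular

variable (K : Type*) [CommRing K] [Algebra ℚ K]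

noncomputable def varInt (k : ℤ) : Sym K :=
  if 0 ≤ k then monomial (unitExpo k.toNat) 1 else 0

noncomputable def jacobiTrudi (l : YoungDiagram) : Sym K :=
  Matrix.det (Matrix.of fun i j : Fin (l.colLen 0) =>
    varInt K ((l.rowLen i : ℤ) - (i : ℤ) + (j : ℤ)))

theorem toComplete_varInt (k : ℤ) : toComplete K (varInt K k) = completeInt K k := by
  unfold varInt completeInt
  split_ifs with h
  · obtain ⟨n, rfl⟩ := Int.eq_ofNat_of_zero_le h
    cases n with
    | zero => simp [unitExpo, complete_zero]
    | succ n =>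
      have h1 : monomial (unitExpo ((n + 1 : ℕ) : ℤ).toNat) (1 : K) = X (Nat.succPNat n) := by
        simp only [Int.toNat_natCast, unitExpo, Nat.succ_pos, if_true, Nat.toPNat']
        rfl
      rw [h1]
      simp [toComplete]
  · simp

theorem completeEquiv_jacobiTrudi (l : YoungDiagram) :
    completeEquiv K (jacobiTrudi K l) = schur K l := by
  change toComplete K (jacobiTrudi K l) = _
  rw [jacobiTrudi, AlgHom.map_det, schur]
  congr 1
  ext1 i j
  simp [toComplete_varInt]

theorem prod_varInt {n : ℕ} (a : Fin n → ℤ) : ∏ i, varInt K (a i) =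
    if ∀ i, 0 ≤ a i then monomial (∑ i, unitExpo (a i).toNat) 1 else 0 := by
  split_ifs with h
  · rw [monomial_sum_one]
    exact Finset.prod_congr rfl fun i _ => by rw [varInt, if_pos (h i)]
  · push Not at h
    obtain ⟨i, hi⟩ := h
    exact Finset.prod_eq_zero (Finset.mem_univ i) (by rw [varInt, if_neg (by omega)])

theorem perm_eq_one_of_monotone {n : ℕ} (s : Equiv.Perm (Fin n)) (h : Monotone s) : s = 1 := by
  have h1 : StrictMono s := h.strictMono_of_injective s.injective
  have h2 : h1.orderIsoOfSurjective s s.surjective = OrderIso.refl _ := Subsingleton.elim _ _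
  ext i
  have h3 : s i = i := congrArg (fun e : Fin n ≃o Fin n => e i) h2
  simp [h3]

theorem jacobiTrudi_triangular (l : YoungDiagram) : ∃ R : Sym K,
    jacobiTrudi K l = monomial (expo l) 1 + R ∧
    ∀ m ∈ R.support, expoWt m = l.card ∧ expoSq (expo l) < expoSq m := by
  classical
  let a : Fin (l.colLen 0) → ℤ := fun i => (l.rowLen i : ℤ) - (i : ℤ)
  let c : Fin (l.colLen 0) → ℤ := fun i => (i : ℤ)
  have ha : StrictAnti a := by
    intro i j hij
    have h1 := l.rowLen_anti i j (by exact_mod_cast hij.le)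
    have h2 : (i : ℕ) < j := hij
    simp only [a]; omega
  let t : Equiv.Perm (Fin (l.colLen 0)) → Sym K := fun s =>
    Equiv.Perm.sign s • ∏ i, varInt K (a (s i) + c i)
  have hdet : jacobiTrudi K l = ∑ s, t s := by
    rw [jacobiTrudi, Matrix.det_apply]; rfl
  have h1 : t 1 = monomial (expo l) 1 := by
    simp only [t, prod_varInt, Equiv.Perm.sign_one, one_smul, Equiv.Perm.one_apply, a, c,
      sub_add_cancel]
    rw [if_pos fun i => by positivity, expo_eq_sum]
    rfl
  refine ⟨∑ s ∈ Finset.univ.erase 1, t s, ?_, ?_⟩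
  · rw [hdet, ← h1, Finset.add_sum_erase _ _ (Finset.mem_univ _)]
  · intro m hm
    obtain ⟨s, hs, hms⟩ := Finset.mem_biUnion.1 (support_sum hm)
    have hs1 : s ≠ 1 := Finset.ne_of_mem_erase hs
    have hpos : ∀ i, 0 ≤ a (s i) + c i := by
      by_contra hcon
      simp only [t, prod_varInt, if_neg hcon, smul_zero, support_zero] at hms
      exact absurd hms (Finset.notMem_empty m)
    have hm' : m = ∑ i, unitExpo (a (s i) + c i).toNat := by
      simp only [t, prod_varInt, if_pos hpos] at hms
      rcases Int.units_eq_one_or (Equiv.Perm.sign s) with hsg | hsg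
      · rw [hsg, one_smul] at hms
        exact Finset.mem_singleton.1 (support_monomial_subset hms)
      · rw [hsg, Units.neg_smul, one_smul, support_neg] at hms
        exact Finset.mem_singleton.1 (support_monomial_subset hms)
    have hcast : ∀ i, (((a (s i) + c i).toNat : ℕ) : ℤ) = a (s i) + c i := fun i =>
      Int.toNat_of_nonneg (hpos i)
    have ha0 : ∀ i, a i + c i = l.rowLen i := fun i => by simp [a, c]
    constructor
    · have : (expoWt m : ℤ) = l.card := by
        rw [hm', map_sum, card_eq_sum]
        push_cast
        simp only [expoWt_unit, hcast]
        rw [Finset.sum_add_distrib, Equiv.sum_comp s a, ← Finset.sum_add_distrib]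
        exact Finset.sum_congr rfl fun i _ => ha0 i
      exact_mod_cast this
    · have hlt : ∑ i, a i * c i < ∑ i, a (s i) * c i := by
        have hav : Antivary a c := by
          intro i j hij
          exact ha.antitone (by simpa [c] using hij.le)
        rw [hav.sum_mul_lt_sum_comp_perm_mul_iff]
        intro hcon
        apply hs1
        apply perm_eq_one_of_monotone
        intro i j hij
        rcases hij.eq_or_lt with rfl | hij
        · exact le_rfl
        · have := hcon (i := i) (j := j) (by simpa [c] using hij)
          exact ha.le_iff_ge.1 this
      have h2 : (expoSq (expo l) : ℤ) < expoSq m := by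
        rw [hm', expo_eq_sum, map_sum, map_sum]
        push_cast
        simp only [expoSq_unit]
        push_cast
        simp only [hcast, ← ha0]
        have e1 : ∀ i, (a i + c i) ^ 2 = a i ^ 2 + c i ^ 2 + 2 * (a i * c i) := fun i => by ring
        have e2 : ∀ i, (a (s i) + c i) ^ 2 = a (s i) ^ 2 + c i ^ 2 + 2 * (a (s i) * c i) :=
          fun i => by ring
        simp only [e2]
        rw [Finset.sum_congr rfl fun i _ => e1 i]
        simp only [Finset.sum_add_distrib, ← Finset.mul_sum]
        rw [Equiv.sum_comp s fun i => a i ^ 2]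
        linarith
      exact_mod_cast h2

theorem span_jacobiTrudi : ⊤ ≤ Submodule.span K (Set.range (jacobiTrudi K)) := by
  have key : ∀ N : ℕ, ∀ m : ℕ+ →₀ ℕ, expoWt m ^ 2 - expoSq m ≤ N →
      monomial m (1 : K) ∈ Submodule.span K (Set.range (jacobiTrudi K)) := by
    intro N
    induction N using Nat.strong_induction_on with
    | _ N ih =>
      intro m hm
      obtain ⟨l, rfl⟩ := expo_bijective.2 m
      obtain ⟨R, hR, hsupp⟩ := jacobiTrudi_triangular K l
      have hR' : R ∈ Submodule.span K (Set.range (jacobiTrudi K)) := by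
        rw [R.as_sum]
        refine Submodule.sum_mem _ fun m' hm' => ?_
        obtain ⟨h1, h2⟩ := hsupp m' hm'
        have h3 := expoSq_le m'
        rw [expoWt_expo] at hm
        rw [h1] at h3
        have h4 := ih (expoWt m' ^ 2 - expoSq m') (by rw [h1]; omega) m' le_rfl
        have h5 : monomial m' (coeff m' R) = coeff m' R • monomial m' (1 : K) := by
          rw [smul_monomial, smul_eq_mul, mul_one]
        rw [h5]
        exact Submodule.smul_mem _ _ h4
      have : monomial (expo l) (1 : K) = jacobiTrudi K l - R := by rw [hR]; ring
      rw [this]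
      exact Submodule.sub_mem _ (Submodule.subset_span ⟨l, rfl⟩) hR'
  intro f _
  rw [f.as_sum]
  refine Submodule.sum_mem _ fun m _ => ?_
  have h5 : monomial m (coeff m f) = coeff m f • monomial m (1 : K) := by
    rw [smul_monomial, smul_eq_mul, mul_one]
  rw [h5]
  exact Submodule.smul_mem _ _ (key _ m le_rfl)

theorem linearIndependent_jacobiTrudi : LinearIndependent K (jacobiTrudi K) := by
  rw [linearIndependent_iff]
  intro c hc
  by_contra hne
  obtain ⟨l, hl, hmin⟩ := Finset.exists_min_image c.support (fun l => expoSq (expo l))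
    (Finsupp.support_nonempty_iff.2 hne)
  have h := congrArg (coeff (expo l)) hc
  rw [Finsupp.linearCombination_apply, Finsupp.sum, coeff_sum, coeff_zero] at h
  rw [Finset.sum_eq_single l] at h
  · obtain ⟨R, hR, hsupp⟩ := jacobiTrudi_triangular K l
    have hz : coeff (expo l) R = 0 := by
      by_contra hz
      exact absurd (hsupp _ (mem_support_iff.2 hz)).2 (lt_irrefl _)
    rw [coeff_smul, hR, coeff_add, coeff_monomial, if_pos rfl, hz, add_zero, smul_eq_mul,
      mul_one] at h
    exact (Finsupp.mem_support_iff.1 hl) h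
  · intro l' hl' hne'
    obtain ⟨R, hR, hsupp⟩ := jacobiTrudi_triangular K l'
    have hz : coeff (expo l) R = 0 := by
      by_contra hz
      exact absurd (hsupp _ (mem_support_iff.2 hz)).2 (not_lt.2 (hmin l' hl'))
    rw [coeff_smul, hR, coeff_add, coeff_monomial,
      if_neg (fun h => hne' (expo_bijective.1 h)), hz, add_zero, smul_zero]
  · intro h'; exact absurd hl h'

/-- The Schur functions form a basis of `Λ`. -/
noncomputable def schurBasis : Module.Basis YoungDiagram K (Sym K) :=
  (Module.Basis.mk (linearIndependent_jacobiTrudi K) (span_jacobiTrudi K)).map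
    (completeEquiv K).toLinearEquiv

@[simp] theorem schurBasis_apply (l : YoungDiagram) : schurBasis K l = schur K l := by
  rw [schurBasis, Module.Basis.map_apply, Module.Basis.mk_apply]
  exact completeEquiv_jacobiTrudi K l

end Triangular


/-! ### Homogeneity of the Schur basis -/

section Grading

variable (K : Type*) [CommRing K] [Algebra ℚ K]

/-- The grading of `Λ`: the power sum `p_k` has degree `k`. -/
def degWeight (k : ℕ+) : ℕ := k

theorem isWeightedHomogeneous_complete (n : ℕ) :
    IsWeightedHomogeneous degWeight (complete K n) n := by
  induction n using Nat.strong_induction_on with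
  | _ n ih =>
    cases n with
    | zero => rw [complete_zero]; exact isWeightedHomogeneous_one K degWeight
    | succ n =>
      have h : (∑ i : Fin (n + 1), (X (Nat.succPNat i) : Sym K) * complete K (n - i)) ∈
          weightedHomogeneousSubmodule K degWeight (n + 1) := by
        refine Submodule.sum_mem _ fun i _ => ?_
        have h1 := (isWeightedHomogeneous_X K degWeight (Nat.succPNat i)).mul
          (ih (n - i) (by omega))
        have h2 : degWeight (Nat.succPNat i) + (n - i) = n + 1 := by
          simp only [degWeight, Nat.succPNat_coe]; omega
        rw [h2] at h1
        exact h1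
      rw [complete, ← algebraMap_smul K]
      exact Submodule.smul_mem _ _ h

theorem isWeightedHomogeneous_schur (l : YoungDiagram) :
    IsWeightedHomogeneous degWeight (schur K l) l.card := by
  rw [← completeEquiv_jacobiTrudi]
  obtain ⟨R, hR, hsupp⟩ := jacobiTrudi_triangular K l
  have hmon : ∀ (m : ℕ+ →₀ ℕ) (c : K), IsWeightedHomogeneous degWeight
      (completeEquiv K (monomial m c)) (expoWt m) := by
    intro m c
    change IsWeightedHomogeneous degWeight (toComplete K (monomial m c)) (expoWt m)
    rw [toComplete, aeval_monomial]
    have h1 := IsWeightedHomogeneous.prod (R := K) m.support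
      (fun k : ℕ+ => complete K k ^ m k) (fun k => m k * (k : ℕ)) (w := degWeight)
      (fun k _ => by simpa using (isWeightedHomogeneous_complete K k).pow (m k))
    have h2 := (isWeightedHomogeneous_C degWeight c).mul h1
    rw [zero_add] at h2
    have h3 : expoWt m = ∑ k ∈ m.support, m k * (k : ℕ) := by
      simp [expoWt, Finsupp.sum, mul_comm]
    rw [h3]
    exact h2
  have h1 : completeEquiv K R ∈ weightedHomogeneousSubmodule K degWeight l.card := by
    rw [R.as_sum, map_sum]
    refine Submodule.sum_mem _ fun m hm => ?_
    have := hmon m (coeff m R)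
    rwa [(hsupp m hm).1] at this
  have h2 := hmon (expo l) 1
  rw [expoWt_expo] at h2
  rw [hR, map_add]
  exact h2.add h1

theorem repr_eq_zero {f : Sym K} {n : ℕ} (hf : IsWeightedHomogeneous degWeight f n)
    {l : YoungDiagram} (hl : l.card ≠ n) : (schurBasis K).repr f l = 0 := by
  classical
  have h1 : f = (schurBasis K).repr.symm
      (((schurBasis K).repr f).filter fun l => l.card = n) := by
    conv_lhs => rw [← hf.weightedHomogeneousComponent_same,
      ← (schurBasis K).linearCombination_repr f]
    rw [Module.Basis.repr_symm_apply, Finsupp.linearCombination_apply,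
      Finsupp.linearCombination_apply, Finsupp.sum, Finsupp.sum, map_sum,
      Finsupp.support_filter, Finset.sum_filter]
    refine Finset.sum_congr rfl fun m _ => ?_
    rw [map_smul, schurBasis_apply]
    split_ifs with h
    · have h2 := isWeightedHomogeneous_schur K m
      rw [h] at h2
      rw [Finsupp.filter_apply_pos (fun l : YoungDiagram => l.card = n) _ h,
        h2.weightedHomogeneousComponent_same]
    · rw [(isWeightedHomogeneous_schur K m).weightedHomogeneousComponent_ne n (Ne.symm h), smul_zero]
  rw [h1, LinearEquiv.apply_symm_apply, Finsupp.filter_apply_neg (fun l : YoungDiagram => l.card = n) _ hl]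

end Grading

theorem finite_card_eq (n : ℕ) : {l : YoungDiagram | l.card = n}.Finite := by
  have hinj : Function.Injective YoungDiagram.cells := fun l l' h => YoungDiagram.ext h
  refine Set.Finite.of_finite_image (f := YoungDiagram.cells) ?_ hinj.injOn
  refine (Finset.finite_toSet (Finset.range n ×ˢ Finset.range n).powerset).subset ?_
  rintro _ ⟨l, hl, rfl⟩
  have hl : l.cells.card = n := hl
  simp only [Finset.coe_powerset, Set.mem_preimage, Set.mem_powerset_iff, Finset.coe_subset]
  rintro ⟨i, j⟩ hc
  have hsub : Finset.range (i + 1) ×ˢ Finset.range (j + 1) ⊆ l.cells := by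
    rintro ⟨a, b⟩ hab
    rw [Finset.mem_product, Finset.mem_range, Finset.mem_range] at hab
    exact l.up_left_mem (by omega) (by omega) hc
  have hcard := Finset.card_le_card hsub
  rw [Finset.card_product, Finset.card_range, Finset.card_range, hl] at hcard
  rw [Finset.mem_product, Finset.mem_range, Finset.mem_range]
  constructor <;> nlinarith

/-! ### Hall inner product, adjoint operators, involution, plethysm -/

section Operations

variable (K : Type*) [CommRing K] [Algebra ℚ K]

/-- The Hall inner product: the bilinear form with `⟨s_l, s_m⟩ = δ_{l m}`. -/
noncomputable def hall : LinearMap.BilinForm K (Sym K) :=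
  (schurBasis K).constr K fun l => (schurBasis K).coord l

open Classical in
theorem hall_schur (l m : YoungDiagram) :
    hall K (schur K l) (schur K m) = if l = m then 1 else 0 := by
  rw [← schurBasis_apply, ← schurBasis_apply, hall, Module.Basis.constr_basis,
    Module.Basis.coord_apply, Module.Basis.repr_self, Finsupp.single_apply]
  simp only [eq_comm]

/-- `f^⊥ g = ∑_m ⟨g, f s_m⟩ s_m`. -/
noncomputable def perp (f g : Sym K) : Sym K :=
  ∑ᶠ m : YoungDiagram, hall K g (f * schur K m) • schur K m

/-- Only finitely many terms of the sum that defines `f^⊥ g` are nonzero. -/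
theorem perp_finite (f g : Sym K) :
    {m : YoungDiagram | hall K g (f * schur K m) ≠ 0}.Finite := by
  have hf : f ∈ Submodule.span K (Set.range (schurBasis K)) := by
    rw [(schurBasis K).span_eq]; trivial
  have hg : g ∈ Submodule.span K (Set.range (schurBasis K)) := by
    rw [(schurBasis K).span_eq]; trivial
  induction hf using Submodule.span_induction with
  | zero => simp
  | add x y _ _ hx hy =>
    refine (hx.union hy).subset fun m hm => ?_
    by_contra hcon
    simp only [Set.mem_union, Set.mem_ofPred_eq, not_or, not_not] at hcon
    exact hm (by rw [add_mul, map_add, hcon.1, hcon.2, add_zero])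
  | smul c x _ hx =>
    refine hx.subset fun m hm h0 => hm ?_
    rw [smul_mul_assoc, map_smul, h0, smul_zero]
  | mem x hx =>
    obtain ⟨a, rfl⟩ := hx
    induction hg using Submodule.span_induction with
    | zero => simp
    | add x y _ _ hx hy =>
      refine (hx.union hy).subset fun m hm => ?_
      by_contra hcon
      simp only [Set.mem_union, Set.mem_ofPred_eq, not_or, not_not] at hcon
      exact hm (by rw [map_add, LinearMap.add_apply, hcon.1, hcon.2, add_zero])
    | smul c x _ hx =>
      refine hx.subset fun m hm h0 => hm ?_
      rw [map_smul, LinearMap.smul_apply, h0, smul_zero]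
    | mem x hx =>
      obtain ⟨b, rfl⟩ := hx
      refine (finite_card_eq (b.card - a.card)).subset fun m hm => ?_
      by_contra hcon
      apply hm
      rw [hall, Module.Basis.constr_basis, Module.Basis.coord_apply, schurBasis_apply]
      refine repr_eq_zero K ((isWeightedHomogeneous_schur K a).mul
        (isWeightedHomogeneous_schur K m)) fun h => hcon ?_
      simp only [Set.mem_ofPred_eq]; omega

/-- `f^⊥` is adjoint to multiplication by `f`. -/
theorem hall_perp (f g h : Sym K) : hall K (perp K f g) h = hall K g (f * h) := by
  classical
  have hlin : (hall K (perp K f g) : Sym K →ₗ[K] K) = (hall K g).comp (LinearMap.mulLeft K f) := by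
    refine (schurBasis K).ext fun l => ?_
    have hfin := perp_finite K f g
    rw [perp, finsum_eq_sum_of_support_subset (s := hfin.toFinset) _ (by
      intro m hm
      rw [Set.Finite.coe_toFinset]
      intro h0
      exact hm (by simp only [h0, zero_smul])), map_sum, LinearMap.sum_apply]
    simp only [map_smul, LinearMap.smul_apply, schurBasis_apply, hall_schur, smul_eq_mul,
      mul_ite, mul_one, mul_zero, Finset.sum_ite_eq', LinearMap.comp_apply,
      LinearMap.mulLeft_apply, Set.Finite.mem_toFinset, Set.mem_ofPred_eq]
    split_ifs with h0
    · rfl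
    · exact (not_not.1 h0).symm
  exact LinearMap.congr_fun hlin h

/-- The standard involution `ω`, with `ω(p_k) = (-1)^{k+1} p_k`. -/
noncomputable def omega : Sym K →ₐ[K] Sym K :=
  aeval fun k : ℕ+ => (-1) ^ ((k : ℕ) + 1) * X k

/-- `p_r[g]` for `g` with rational coefficients: every `p_k` in `g` is replaced by `p_{rk}`. -/
noncomputable def powerPleth (r : ℕ+) : Sym ℚ →ₐ[ℚ] Sym ℚ :=
  aeval fun k : ℕ+ => X (r * k)

/-- The plethysm `f[g]`, for `g` with rational coefficients: every `p_r` in `f` is replaced by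
`p_r[g]`. -/
noncomputable def pleth (f : Sym K) (g : Sym ℚ) : Sym K :=
  aeval (fun r : ℕ+ => map (algebraMap ℚ K) (powerPleth r g)) f

end Operations

/-- The one-column partition `1^r`. -/
def column (r : ℕ) : YoungDiagram where
  cells := Finset.range r ×ˢ {0}
  isLowerSet := by
    rintro ⟨i, j⟩ ⟨i', j'⟩ ⟨hi, hj⟩ h
    simp only [Finset.coe_product, Finset.coe_range, Finset.coe_singleton, Set.mem_prod,
      Set.mem_Iio, Set.mem_singleton_iff] at h hi hj ⊢
    omega

theorem finite_sequences (n d r : ℕ) : {v : Fin (n + 1) → YoungDiagram |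
    ∑ i, (v i).card = d ∧ ∑ i : Fin (n + 1), (i : ℕ) * (v i).card = r}.Finite := by
  have hfin : {l : YoungDiagram | l.card ≤ d}.Finite := by
    refine ((Finset.range (d + 1)).finite_toSet.biUnion fun e _ => finite_card_eq e).subset ?_
    intro l hl
    simp only [Set.mem_iUnion]
    exact ⟨l.card, Finset.mem_coe.2 (Finset.mem_range.2 (Nat.lt_succ_of_le hl)), rfl⟩
  refine (Set.Finite.pi' fun _ : Fin (n + 1) => hfin).subset ?_
  rintro v ⟨hv, -⟩ i
  rw [Set.mem_ofPred_eq, ← hv]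
  exact Finset.single_le_sum (f := fun i => (v i).card) (fun _ _ => Nat.zero_le _)
    (Finset.mem_univ i)

/-- The sequences of partitions `(v_0, …, v_n)` with `∑ |v_i| = d` and `∑ i |v_i| = r`. -/
noncomputable def sequences (n d r : ℕ) : Finset (Fin (n + 1) → YoungDiagram) :=
  (finite_sequences n d r).toFinset

theorem mem_sequences {n d r : ℕ} {v : Fin (n + 1) → YoungDiagram} : v ∈ sequences n d r ↔
    ∑ i, (v i).card = d ∧ ∑ i : Fin (n + 1), (i : ℕ) * (v i).card = r := by
  rw [sequences, Set.Finite.mem_toFinset, Set.mem_ofPred_eq]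

/-! ### Schur functions as generating functions of semistandard tableaux -/

section Tableaux

/-- The determinant `det (h_{a_i - i + j})` of size `N`. -/
noncomputable def jtDet {A : Type*} [CommRing A] (h : ℤ → A) (N : ℕ) (a : ℕ → ℕ) : A :=
  Matrix.det (Matrix.of fun i j : Fin N => h ((a i : ℤ) - (i : ℤ) + (j : ℤ)))

theorem jtDet_succ {A : Type*} [CommRing A] (h : ℤ → A) (h0 : h 0 = 1)
    (hneg : ∀ k < 0, h k = 0) (N : ℕ) (a : ℕ → ℕ) (ha : a N = 0) :
    jtDet h (N + 1) a = jtDet h N a := by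
  rw [jtDet, Matrix.det_succ_row _ (Fin.last N), Finset.sum_eq_single (Fin.last N)]
  · simp only [Fin.val_last, Matrix.of_apply, ha, Nat.cast_zero, zero_sub, neg_add_cancel, h0]
    rw [← two_mul, pow_mul, neg_one_sq, one_pow, one_mul, one_mul, jtDet]
    congr 1
    ext i j
    simp [Matrix.submatrix_apply]
  · intro j _ hj
    have hj' : (j : ℕ) < N := by
      have := Fin.val_lt_last hj
      exact this
    rw [Matrix.of_apply, hneg, mul_zero, zero_mul]
    simp only [Fin.val_last, ha]
    omega
  · intro hcon; exact absurd (Finset.mem_univ _) hcon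

theorem jtDet_padding {A : Type*} [CommRing A] (h : ℤ → A) (h0 : h 0 = 1)
    (hneg : ∀ k < 0, h k = 0) (a : ℕ → ℕ) (L N : ℕ) (hLN : L ≤ N) (ha : ∀ i, L ≤ i → a i = 0) :
    jtDet h N a = jtDet h L a := by
  induction N, hLN using Nat.le_induction with
  | base => rfl
  | succ N hN ih => rw [jtDet_succ h h0 hneg N a (ha N hN), ih]

theorem rec_iterate {A : Type*} [CommRing A] {h H : ℤ → A} {t : A}
    (hrec : ∀ k, H k = h k + t * H (k - 1)) (d : ℕ) (k : ℤ) :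
    H k - t ^ d * H (k - d) = ∑ m ∈ Finset.range d, t ^ m * h (k - m) := by
  induction d with
  | zero => simp
  | succ d ih =>
    rw [Finset.sum_range_succ, ← ih, hrec (k - d)]
    push_cast
    rw [show k - (d : ℤ) - 1 = k - (d + 1) by ring]
    ring

/-- Branching: adding one variable to the alphabet. -/
theorem jtDet_branch {A : Type*} [CommRing A] {h H : ℤ → A} {t : A}
    (hrec : ∀ k, H k = h k + t * H (k - 1)) (Hneg : ∀ k < 0, H k = 0) (N : ℕ) (a : ℕ → ℕ)
    (ha : Antitone a) (haN : a N = 0) :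
    jtDet H N a = ∑ m ∈ Fintype.piFinset fun i : Fin N => Finset.range (a i - a (i + 1) + 1),
      t ^ (∑ i, m i) *
        Matrix.det (Matrix.of fun i j : Fin N => h ((a i : ℤ) - m i - (i : ℤ) + (j : ℤ))) := by
  let M : Matrix (Fin N) (Fin N) A := Matrix.of fun i j => H ((a i : ℤ) - (i : ℤ) + (j : ℤ))
  let U : Matrix (Fin N) (Fin N) A := Matrix.of fun i k =>
    if i = k then 1 else if (i : ℕ) + 1 = k then - t ^ (a i - a (i + 1) + 1) else 0
  have hU : U.det = 1 := by
    rw [Matrix.det_of_isUpperTriangular]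
    · simp [U]
    · intro i j hij
      have hij' : (j : ℕ) < i := hij
      have h1 : i ≠ j := fun h => by rw [h] at hij'; exact lt_irrefl _ hij'
      have h2 : (i : ℕ) + 1 ≠ j := by omega
      simp [U, h1, h2]
  have hUM : U * M = Matrix.of fun i j : Fin N =>
      ∑ m ∈ Finset.range (a i - a (i + 1) + 1),
        t ^ m * h ((a i : ℤ) - m - (i : ℤ) + (j : ℤ)) := by
    ext i j
    rw [Matrix.mul_apply, Matrix.of_apply]
    have hle : a (i + 1) ≤ a i := ha (Nat.le_succ _)
    have hs : ∑ k, U i k * M k j = M i j - t ^ (a i - a (i + 1) + 1) *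
        H ((a (i + 1) : ℤ) - ((i : ℤ) + 1) + j) := by
      have hsplit : ∀ k, U i k * M k j = (if i = k then M k j else 0) +
          (if (i : ℕ) + 1 = k then - t ^ (a i - a (i + 1) + 1) * M k j else 0) := by
        intro k
        by_cases h1 : i = k
        · have h2 : ¬ ((i : ℕ) + 1 = k) := by rw [h1]; omega
          simp [U, h1]
        · by_cases h2 : (i : ℕ) + 1 = k <;> simp [U, h1, h2]
      rw [Finset.sum_congr rfl fun k _ => hsplit k, Finset.sum_add_distrib,
        Finset.sum_ite_eq, if_pos (Finset.mem_univ _), sub_eq_add_neg]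
      congr 1
      by_cases hi : (i : ℕ) + 1 < N
      · rw [Finset.sum_eq_single (⟨i + 1, hi⟩ : Fin N)]
        · simp [M]
        · intro k _ hk
          rw [if_neg]
          intro h; exact hk (Fin.ext h.symm)
        · intro hcon; exact absurd (Finset.mem_univ _) hcon
      · have hiN : (i : ℕ) + 1 = N := by omega
        rw [Finset.sum_eq_zero, hiN, haN, Hneg]
        · simp
        · push_cast; omega
        · intro k _
          rw [if_neg]; omega
    rw [hs]
    have := rec_iterate hrec (a i - a (i + 1) + 1) ((a i : ℤ) - (i : ℤ) + (j : ℤ))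
    rw [show ((a (i + 1) : ℤ) - ((i : ℤ) + 1) + j) =
      ((a i : ℤ) - (i : ℤ) + (j : ℤ)) - ((a i - a (i + 1) + 1 : ℕ) : ℤ) by push_cast [hle]; ring]
    change H _ - _ = _
    rw [this]
    refine Finset.sum_congr rfl fun m _ => ?_
    congr 2; ring
  have hM : jtDet H N a = (U * M).det := by rw [Matrix.det_mul, hU, one_mul]; rfl
  rw [hM, hUM]
  have hrow : (Matrix.of fun i j : Fin N => ∑ m ∈ Finset.range (a i - a (i + 1) + 1),
        t ^ m * h ((a i : ℤ) - m - (i : ℤ) + (j : ℤ))) =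
      Matrix.of fun i : Fin N => ∑ m ∈ Finset.range (a i - a (i + 1) + 1),
        (fun j : Fin N => t ^ m * h ((a i : ℤ) - m - (i : ℤ) + (j : ℤ))) := by
    ext i j; simp
  rw [hrow]
  have hml := (Matrix.detRowAlternating (n := Fin N) (R := A)).toMultilinearMap.map_sum_finset
    (fun (i : Fin N) (m : ℕ) =>
      (fun j : Fin N => t ^ m * h ((a i : ℤ) - m - (i : ℤ) + (j : ℤ))))
    (fun i : Fin N => Finset.range (a i - a (i + 1) + 1))
  refine hml.trans (Finset.sum_congr rfl fun m _ => ?_)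
  rw [← Finset.prod_pow_eq_pow_sum, ← Matrix.det_mul_column]
  rfl

/-- The diagram whose rows have lengths `b 0, …, b (N - 1)`. -/
def ofRows (N : ℕ) (b : ℕ → ℕ) (hb : Antitone b) : YoungDiagram where
  cells := (Finset.range N ×ˢ Finset.range (b 0)).filter fun c => c.2 < b c.1
  isLowerSet := by
    rintro ⟨i, j⟩ ⟨i', j'⟩ ⟨hi, hj⟩ h
    simp only [Finset.coe_filter, Finset.mem_product, Finset.mem_range, Set.mem_ofPred_eq]
      at h hi hj ⊢
    have := hb hi
    omega

theorem rowLen_ofRows (N : ℕ) (b : ℕ → ℕ) (hb : Antitone b) (i : ℕ) :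
    (ofRows N b hb).rowLen i = if i < N then b i else 0 := by
  have h : ∀ j, j < (ofRows N b hb).rowLen i ↔ j < if i < N then b i else 0 := by
    intro j
    rw [← YoungDiagram.mem_iff_lt_rowLen, ← YoungDiagram.mem_cells]
    have := hb (Nat.zero_le i)
    simp only [ofRows, Finset.mem_filter, Finset.mem_product, Finset.mem_range]
    split_ifs <;> omega
  exact le_antisymm (not_lt.1 fun hlt => lt_irrefl _ ((h _).1 hlt))
    (not_lt.1 fun hlt => lt_irrefl _ ((h _).2 hlt))

theorem ext_rowLen {l l' : YoungDiagram} (h : ∀ i, l.rowLen i = l'.rowLen i) : l = l' := by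
  refine YoungDiagram.ext ?_
  ext ⟨i, j⟩
  rw [YoungDiagram.mem_cells, YoungDiagram.mem_cells, YoungDiagram.mem_iff_lt_rowLen,
    YoungDiagram.mem_iff_lt_rowLen, h]

theorem rowLen_eq_zero {l : YoungDiagram} {i : ℕ} (h : l.colLen 0 ≤ i) : l.rowLen i = 0 := by
  by_contra hne
  have h1 : (i, 0) ∈ l := YoungDiagram.mem_iff_lt_rowLen.2 (Nat.pos_of_ne_zero hne)
  have := YoungDiagram.mem_iff_lt_colLen.1 h1
  omega

theorem rowLen_mono {l l' : YoungDiagram} (h : l ≤ l') (i : ℕ) : l.rowLen i ≤ l'.rowLen i := by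
  by_contra hlt
  rw [not_le, ← YoungDiagram.mem_iff_lt_rowLen] at hlt
  exact lt_irrefl _ (YoungDiagram.mem_iff_lt_rowLen.1 (h hlt))

theorem le_of_rowLen {l l' : YoungDiagram} (h : ∀ i, l.rowLen i ≤ l'.rowLen i) : l ≤ l' := by
  rintro ⟨i, j⟩ hc
  exact YoungDiagram.mem_iff_lt_rowLen.2
    ((YoungDiagram.mem_iff_lt_rowLen.1 hc).trans_le (h i))

theorem colLen_le_of_rowLen {l l' : YoungDiagram} (h : ∀ i, l.rowLen i ≤ l'.rowLen i) :
    l.colLen 0 ≤ l'.colLen 0 := by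
  by_contra hlt
  rw [not_le, ← YoungDiagram.mem_iff_lt_colLen] at hlt
  exact lt_irrefl _ (YoungDiagram.mem_iff_lt_colLen.1 (le_of_rowLen h hlt))

theorem card_eq_sum_of_le {l : YoungDiagram} {N : ℕ} (h : l.colLen 0 ≤ N) :
    l.card = ∑ i : Fin N, l.rowLen i := by
  rw [card_eq_sum, ← Finset.sum_range (fun i => l.rowLen i),
    ← Finset.sum_range (fun i => l.rowLen i)]
  refine Finset.sum_subset (Finset.range_mono h) fun i _ hi => rowLen_eq_zero ?_
  rw [Finset.mem_range] at hi; omega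

theorem finite_strips (l : YoungDiagram) : {k : YoungDiagram |
    ∀ i, l.rowLen (i + 1) ≤ k.rowLen i ∧ k.rowLen i ≤ l.rowLen i}.Finite := by
  have hinj : Function.Injective YoungDiagram.cells := fun l l' h => YoungDiagram.ext h
  refine Set.Finite.of_finite_image (f := YoungDiagram.cells) ?_ hinj.injOn
  refine (Finset.finite_toSet l.cells.powerset).subset ?_
  rintro _ ⟨k, hk, rfl⟩
  have h1 : k ≤ l := le_of_rowLen fun i => (hk i).2
  exact Finset.mem_coe.2 (Finset.mem_powerset.2 (YoungDiagram.cells_subset_iff.2 h1))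

/-- The partitions `k` such that `l / k` is a horizontal strip. -/
noncomputable def strips (l : YoungDiagram) : Finset YoungDiagram := (finite_strips l).toFinset

theorem mem_strips {l k : YoungDiagram} : k ∈ strips l ↔
    ∀ i, l.rowLen (i + 1) ≤ k.rowLen i ∧ k.rowLen i ≤ l.rowLen i := by
  rw [strips, Set.Finite.mem_toFinset, Set.mem_ofPred_eq]

theorem jtDet_strips {A : Type*} [CommRing A] {h H : ℤ → A} {t : A} (h0 : h 0 = 1)
    (hneg : ∀ k < 0, h k = 0) (hrec : ∀ k, H k = h k + t * H (k - 1))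
    (Hneg : ∀ k < 0, H k = 0) (l : YoungDiagram) :
    jtDet H (l.colLen 0) l.rowLen =
      ∑ k ∈ strips l, t ^ (l.card - k.card) * jtDet h (k.colLen 0) k.rowLen := by
  have hanti : Antitone l.rowLen := fun i j hij => l.rowLen_anti i j hij
  rw [jtDet_branch hrec Hneg _ _ hanti (rowLen_eq_zero le_rfl)]
  symm
  refine Finset.sum_bij (fun k _ => fun i : Fin (l.colLen 0) => l.rowLen i - k.rowLen i) ?_ ?_ ?_ ?_
  · intro k hk
    rw [mem_strips] at hk
    rw [Fintype.mem_piFinset]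
    intro i
    have := hk i
    rw [Finset.mem_range]; omega
  · intro k hk k' hk' heq
    rw [mem_strips] at hk hk'
    refine ext_rowLen fun i => ?_
    have h1 := hk i
    have h2 := hk' i
    by_cases hi : i < l.colLen 0
    · have := congrFun heq ⟨i, hi⟩
      simp only at this
      omega
    · have := rowLen_eq_zero (not_lt.1 hi)
      omega
  · intro m hm
    rw [Fintype.mem_piFinset] at hm
    let b : ℕ → ℕ := fun i => if hi : i < l.colLen 0 then l.rowLen i - m ⟨i, hi⟩ else 0
    have hb1 : ∀ i, l.rowLen (i + 1) ≤ b i ∧ b i ≤ l.rowLen i := by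
      intro i
      simp only [b]
      split_ifs with hi
      · have := hm ⟨i, hi⟩
        rw [Finset.mem_range] at this
        have := hanti (Nat.le_succ i)
        simp only [Nat.succ_eq_add_one] at *
        omega
      · have := rowLen_eq_zero (not_lt.1 hi)
        have := hanti (Nat.le_succ i)
        simp only [Nat.succ_eq_add_one] at *
        omega
    have hb : Antitone b := antitone_nat_of_succ_le fun i => (hb1 (i + 1)).2.trans (hb1 i).1
    have hrow : ∀ i, (ofRows (l.colLen 0) b hb).rowLen i = b i := by
      intro i
      rw [rowLen_ofRows]
      split_ifs with hi
      · rfl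
      · simp [b, hi]
    refine ⟨ofRows (l.colLen 0) b hb, ?_, ?_⟩
    · rw [mem_strips]
      intro i
      rw [hrow]
      exact hb1 i
    · funext i
      have h1 := hm i
      rw [Finset.mem_range] at h1
      have h2 : (ofRows (l.colLen 0) b hb).rowLen i = l.rowLen i - m i := by
        rw [hrow]; simp [b]
      simp only [h2]
      omega
  · intro k hk
    rw [mem_strips] at hk
    have hle : k.colLen 0 ≤ l.colLen 0 := colLen_le_of_rowLen fun i => (hk i).2
    rw [← jtDet_padding h h0 hneg k.rowLen _ _ hle fun i hi => rowLen_eq_zero hi]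
    congr 1
    · congr 1
      rw [card_eq_sum_of_le hle, card_eq_sum]
      exact (Finset.sum_tsub_distrib (f := fun i : Fin (l.colLen 0) => l.rowLen i)
        (g := fun i => k.rowLen i) _ fun i _ => (hk i).2).symm
    · rw [jtDet]
      congr 1
      ext i j
      have := (hk i).2
      simp only [Matrix.of_apply]
      congr 2
      push_cast [this]
      ring

theorem finite_tableaux (n : ℕ) (l : YoungDiagram) :
    {T : SemistandardYoungTableau l | ∀ i j, (i, j) ∈ l → T i j < n}.Finite := by
  let f : SemistandardYoungTableau l → (l.cells → ℕ) := fun T c => T c.1.1 c.1.2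
  have hinj : Function.Injective f := by
    intro T T' h
    ext i j
    by_cases hc : (i, j) ∈ l
    · exact congrFun h ⟨(i, j), hc⟩
    · rw [T.zeros hc, T'.zeros hc]
  refine Set.Finite.of_finite_image (f := f) ?_ hinj.injOn
  refine (Set.Finite.pi' fun _ : l.cells => (Finset.range n).finite_toSet).subset ?_
  rintro _ ⟨T, hT, rfl⟩ c
  exact Finset.mem_coe.2 (Finset.mem_range.2 (hT _ _ c.2))

/-- The semistandard tableaux of shape `l` with entries in `{0, …, n - 1}`. -/
noncomputable def tableaux (n : ℕ) (l : YoungDiagram) : Finset (SemistandardYoungTableau l) :=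
  (finite_tableaux n l).toFinset

theorem mem_tableaux {n : ℕ} {l : YoungDiagram} {T : SemistandardYoungTableau l} :
    T ∈ tableaux n l ↔ ∀ i j, (i, j) ∈ l → T i j < n := by
  rw [tableaux, Set.Finite.mem_toFinset, Set.mem_ofPred_eq]

/-- The Schur polynomial in the variables `x_0, …, x_{n-1}`: the sum of `x^{weight(T)}` over the
semistandard tableaux `T` of shape `l`. -/
noncomputable def schurPoly (K : Type*) [CommRing K] (n : ℕ) (l : YoungDiagram) :
    MvPolynomial ℕ K :=
  ∑ T ∈ tableaux n l, ∏ c ∈ l.cells, X (T c.1 c.2)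

theorem schurPoly_zero (K : Type*) [CommRing K] (l : YoungDiagram) :
    schurPoly K 0 l = if l.card = 0 then 1 else 0 := by
  split_ifs with h
  · have hl : l.cells = ∅ := Finset.card_eq_zero.1 h
    have hT : ∀ i j, (i, j) ∉ l := fun i j hc => by
      rw [← YoungDiagram.mem_cells, hl] at hc
      exact Finset.notMem_empty _ hc
    rw [schurPoly, Finset.sum_eq_single default]
    · rw [hl, Finset.prod_empty]
    · intro T _ hne
      refine absurd ?_ hne
      ext i j
      rw [T.zeros (hT i j), SemistandardYoungTableau.zeros _ (hT i j)]
    · intro hcon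
      exact absurd (mem_tableaux.2 fun i j hc => absurd hc (hT i j)) hcon
  · obtain ⟨c, hc⟩ := Finset.card_pos.1 (Nat.pos_of_ne_zero h)
    rw [schurPoly, Finset.sum_eq_zero]
    intro T hT
    exact absurd (mem_tableaux.1 hT c.1 c.2 hc) (Nat.not_lt_zero _)

/-- The cells of a tableau whose entry is less than `n`. -/
def lowerPart {l : YoungDiagram} (T : SemistandardYoungTableau l) (n : ℕ) : YoungDiagram where
  cells := l.cells.filter fun c => T c.1 c.2 < n
  isLowerSet := by
    rintro ⟨i, j⟩ ⟨i', j'⟩ ⟨hi, hj⟩ h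
    simp only [Finset.coe_filter, YoungDiagram.mem_cells, Set.mem_ofPred_eq] at h hi hj ⊢
    have h1 : (i, j') ∈ l := l.up_left_mem le_rfl hj h.1
    exact ⟨l.up_left_mem hi hj h.1,
      ((T.col_weak hi h1).trans (T.row_weak_of_le hj h.1)).trans_lt h.2⟩

theorem mem_lowerPart {l : YoungDiagram} {T : SemistandardYoungTableau l} {n : ℕ} {i j : ℕ} :
    (i, j) ∈ lowerPart T n ↔ (i, j) ∈ l ∧ T i j < n := by
  rw [← YoungDiagram.mem_cells, lowerPart, Finset.mem_filter, YoungDiagram.mem_cells]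

/-- Restriction of a tableau to a smaller shape. -/
def restrictTab {l k : YoungDiagram} (h : k ≤ l) (T : SemistandardYoungTableau l) :
    SemistandardYoungTableau k where
  entry i j := if (i, j) ∈ k then T i j else 0
  row_weak' hj hc := by
    rw [if_pos hc, if_pos (k.up_left_mem le_rfl hj.le hc)]
    exact T.row_weak hj (h hc)
  col_strict' hi hc := by
    rw [if_pos hc, if_pos (k.up_left_mem hi.le le_rfl hc)]
    exact T.col_strict hi (h hc)
  zeros' hc := if_neg hc

/-- Extension of a tableau by the entry `n` along a horizontal strip. -/
def extendTab {l k : YoungDiagram} {n : ℕ} (h : k ∈ strips l) (S : SemistandardYoungTableau k)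
    (hS : S ∈ tableaux n k) : SemistandardYoungTableau l where
  entry i j := if (i, j) ∈ k then S i j else if (i, j) ∈ l then n else 0
  row_weak' {i j1 j2} hj hc := by
    by_cases h2 : (i, j2) ∈ k
    · rw [if_pos h2, if_pos (k.up_left_mem le_rfl hj.le h2)]
      exact S.row_weak hj h2
    · rw [if_neg h2, if_pos hc]
      split_ifs with h1 h3
      · exact (mem_tableaux.1 hS _ _ h1).le
      · exact le_rfl
      · exact Nat.zero_le _
  col_strict' {i1 i2 j} hi hc := by
    by_cases h2 : (i2, j) ∈ k
    · rw [if_pos h2, if_pos (k.up_left_mem hi.le le_rfl h2)]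
      exact S.col_strict hi h2
    · have h3 : (i1 + 1, j) ∈ l := l.up_left_mem hi le_rfl hc
      have h1 : (i1, j) ∈ k := YoungDiagram.mem_iff_lt_rowLen.2
        ((YoungDiagram.mem_iff_lt_rowLen.1 h3).trans_le (mem_strips.1 h i1).1)
      rw [if_neg h2, if_pos hc, if_pos h1]
      exact mem_tableaux.1 hS _ _ h1
  zeros' {i j} hc := by
    have h1 : (i, j) ∉ k := fun h1 => hc (le_of_rowLen (fun i => (mem_strips.1 h i).2) h1)
    rw [if_neg h1, if_neg hc]

theorem schurPoly_succ (K : Type*) [CommRing K] (n : ℕ) (l : YoungDiagram) :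
    schurPoly K (n + 1) l = ∑ k ∈ strips l, X n ^ (l.card - k.card) * schurPoly K n k := by
  classical
  have hmaps : ∀ T ∈ tableaux (n + 1) l, lowerPart T n ∈ strips l := by
    intro T hT
    rw [mem_strips]
    intro i
    constructor
    · by_contra hlt
      rw [not_le, ← YoungDiagram.mem_iff_lt_rowLen] at hlt
      refine lt_irrefl _ (YoungDiagram.mem_iff_lt_rowLen.1 (mem_lowerPart.2
        ⟨l.up_left_mem (Nat.le_succ i) le_rfl hlt, ?_⟩))
      have h1 := T.col_strict (Nat.lt_succ_self i) hlt
      have h2 := mem_tableaux.1 hT _ _ hlt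
      simp only [Nat.succ_eq_add_one] at h1
      omega
    · exact rowLen_mono (fun c hc => (mem_lowerPart.1 hc).1) i
  rw [schurPoly, ← Finset.sum_fiberwise_of_maps_to hmaps]
  refine Finset.sum_congr rfl fun k hk => ?_
  have hkl : k ≤ l := le_of_rowLen fun i => (mem_strips.1 hk i).2
  rw [schurPoly, Finset.mul_sum]
  refine Finset.sum_bij' (fun T _ => restrictTab hkl T) (fun S hS => extendTab hk S hS)
    ?_ ?_ ?_ ?_ ?_
  · intro T hT
    obtain ⟨hT1, rfl⟩ := Finset.mem_filter.1 hT
    rw [mem_tableaux]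
    intro i j hc
    change (if (i, j) ∈ lowerPart T n then T i j else 0) < n
    rw [if_pos hc]
    exact (mem_lowerPart.1 hc).2
  · intro S hS
    rw [Finset.mem_filter, mem_tableaux]
    constructor
    · intro i j hc
      change (if (i, j) ∈ k then S i j else if (i, j) ∈ l then n else 0) < n + 1
      split_ifs with h
      · exact (mem_tableaux.1 hS _ _ h).trans (Nat.lt_succ_self n)
      · exact Nat.lt_succ_self n
    · refine YoungDiagram.ext ?_
      ext ⟨i, j⟩
      rw [YoungDiagram.mem_cells, YoungDiagram.mem_cells, mem_lowerPart]
      change (_ ∧ (if (i, j) ∈ k then S i j else if (i, j) ∈ l then n else 0) < n) ↔ _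
      by_cases h : (i, j) ∈ k
      · simp only [h, if_true, iff_true]
        exact ⟨hkl h, mem_tableaux.1 hS _ _ h⟩
      · simp only [h, if_false, iff_false, not_and]
        intro h'
        rw [if_pos h']
        exact lt_irrefl n
  · intro T hT
    obtain ⟨hT1, rfl⟩ := Finset.mem_filter.1 hT
    ext i j
    change (if (i, j) ∈ lowerPart T n then
      (if (i, j) ∈ lowerPart T n then T i j else 0) else if (i, j) ∈ l then n else 0) = T i j
    by_cases h : (i, j) ∈ l
    · by_cases h1 : (i, j) ∈ lowerPart T n
      · simp only [h1, if_true]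
      · have h2 : ¬ T i j < n := fun h2 => h1 (mem_lowerPart.2 ⟨h, h2⟩)
        have h3 := mem_tableaux.1 hT1 _ _ h
        simp only [h1, if_false, h, if_true]
        omega
    · have h1 : (i, j) ∉ lowerPart T n := fun h1 => h (mem_lowerPart.1 h1).1
      simp only [h1, h, if_false]
      exact (T.zeros h).symm
  · intro S hS
    ext i j
    change (if (i, j) ∈ k then
      (if (i, j) ∈ k then S i j else if (i, j) ∈ l then n else 0) else 0) = S i j
    by_cases h : (i, j) ∈ k
    · simp only [h, if_true]
    · simp only [h, if_false]
      exact (S.zeros h).symm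
  · intro T hT
    obtain ⟨hT1, rfl⟩ := Finset.mem_filter.1 hT
    have hsub : (lowerPart T n).cells ⊆ l.cells := Finset.filter_subset _ _
    rw [← Finset.prod_sdiff hsub]
    congr 1
    · rw [YoungDiagram.card, YoungDiagram.card, ← Finset.card_sdiff_of_subset hsub]
      refine Finset.prod_eq_pow_card fun c hc => ?_
      rw [Finset.mem_sdiff] at hc
      have h1 : ¬ T c.1 c.2 < n := fun h1 => hc.2 (mem_lowerPart.2 ⟨hc.1, h1⟩)
      have h2 := mem_tableaux.1 hT1 _ _ hc.1
      have h3 : T c.1 c.2 = n := by omega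
      rw [h3]
    · refine Finset.prod_congr rfl fun c hc => ?_
      change X (T c.1 c.2) = X (if (c.1, c.2) ∈ lowerPart T n then T c.1 c.2 else 0)
      rw [if_pos (show (c.1, c.2) ∈ lowerPart T n from hc)]

variable (K : Type*) [CommRing K] [Algebra ℚ K]

/-- Evaluation of a symmetric function in the variables `x_0, …, x_{n-1}`: the power sum `p_k` goes
to `x_0 ^ k + ⋯ + x_{n-1} ^ k`. -/
noncomputable def inVars (n : ℕ) : Sym K →ₐ[K] MvPolynomial ℕ K :=
  aeval fun k : ℕ+ => ∑ i ∈ Finset.range n, X i ^ (k : ℕ)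

theorem inVars_qsmul (n : ℕ) (c : ℚ) (x : Sym K) : inVars K n (c • x) = c • inVars K n x :=
  map_rat_smul (inVars K n) c x

theorem inVars_newton (n k : ℕ) : ((k + 1 : ℚ)) • inVars K n (complete K (k + 1)) =
    ∑ i ∈ Finset.range (k + 1),
      (∑ a ∈ Finset.range n, X a ^ (i + 1)) * inVars K n (complete K (k - i)) := by
  rw [← inVars_qsmul, complete_succ, map_sum]
  refine Finset.sum_congr rfl fun i _ => ?_
  rw [map_mul]
  simp [inVars]

/-- `h_k(x_0, …, x_n) = ∑_m x_n^m h_{k-m}(x_0, …, x_{n-1})`, in recursive form. -/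
noncomputable def branchAux (n : ℕ) : ℕ → MvPolynomial ℕ K
  | 0 => 1
  | k + 1 => inVars K n (complete K (k + 1)) + X n * branchAux n k

theorem branchAux_newton (n k : ℕ) : ((k + 1 : ℚ)) • branchAux K n (k + 1) =
    ∑ i ∈ Finset.range (k + 1),
      (∑ a ∈ Finset.range (n + 1), X a ^ (i + 1)) * branchAux K n (k - i) := by
  simp only [Finset.sum_range_succ _ n, add_mul, Finset.sum_add_distrib]
  induction k with
  | zero =>
    have h := inVars_newton K n 0
    simp only [zero_add, Finset.sum_range_one, complete_zero, map_one, mul_one, Nat.cast_zero,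
      one_smul, pow_one, Nat.sub_self] at h
    simp [branchAux, h]
  | succ k ih =>
    have hP : ∑ i ∈ Finset.range (k + 1 + 1),
        (∑ a ∈ Finset.range n, X a ^ (i + 1)) * branchAux K n (k + 1 - i) =
        ((k + 1 + 1 : ℚ)) • inVars K n (complete K (k + 1 + 1)) + X n *
          ∑ i ∈ Finset.range (k + 1),
            (∑ a ∈ Finset.range n, X a ^ (i + 1)) * branchAux K n (k - i) := by
      have h := inVars_newton K n (k + 1)
      push_cast at h
      rw [h, Finset.sum_range_succ _ (k + 1), Finset.sum_range_succ _ (k + 1), Nat.sub_self,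
        complete_zero, map_one, show branchAux K n 0 = 1 from rfl, Finset.mul_sum,
        add_right_comm _ _ (∑ i ∈ _, _), ← Finset.sum_add_distrib]
      congr 1
      refine Finset.sum_congr rfl fun i hi => ?_
      have hi := Finset.mem_range.1 hi
      rw [show k + 1 - i = (k - i) + 1 by omega, branchAux]
      ring
    have hS : ∑ i ∈ Finset.range (k + 1 + 1), (X n : MvPolynomial ℕ K) ^ (i + 1) *
          branchAux K n (k + 1 - i) =
        X n * branchAux K n (k + 1) + X n * ∑ i ∈ Finset.range (k + 1),
          X n ^ (i + 1) * branchAux K n (k - i) := by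
      rw [Finset.sum_range_succ', Finset.mul_sum, add_comm]
      congr 1
      · simp
      · refine Finset.sum_congr rfl fun i _ => ?_
        rw [show k + 1 - (i + 1) = k - i by omega]
        ring
    rw [hP, hS, branchAux]
    have h2 := congrArg (fun y => (X n : MvPolynomial ℕ K) * y) ih
    simp only [mul_add, mul_smul_comm] at h2
    push_cast
    rw [smul_add]
    have h3 : ((k : ℚ) + 1 + 1) • ((X n : MvPolynomial ℕ K) * branchAux K n (k + 1)) =
      ((k : ℚ) + 1) • (X n * branchAux K n (k + 1)) + X n * branchAux K n (k + 1) := by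
      rw [add_smul _ (1 : ℚ), one_smul]
    rw [h3, h2]
    ring

theorem inVars_complete_eq (n k : ℕ) : inVars K (n + 1) (complete K k) = branchAux K n k := by
  induction k using Nat.strong_induction_on with
  | _ k ih =>
    cases k with
    | zero => simp [complete_zero, branchAux]
    | succ k =>
      have h0 : ((k + 1 : ℚ)) ≠ 0 := by positivity
      have key : ((k + 1 : ℚ)) • inVars K (n + 1) (complete K (k + 1)) =
          ((k + 1 : ℚ)) • branchAux K n (k + 1) := by
        rw [inVars_newton, branchAux_newton]
        refine Finset.sum_congr rfl fun i _ => ?_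
        rw [ih (k - i) (by omega)]
      have := congrArg (fun x => ((k + 1 : ℚ)⁻¹) • x) key
      simpa [smul_smul, inv_mul_cancel₀ h0] using this

theorem completeInt_neg {k : ℤ} (hk : k < 0) : completeInt K k = 0 := if_neg (not_le.2 hk)

theorem completeInt_natCast (k : ℕ) : completeInt K (k : ℤ) = complete K k := by
  rw [completeInt, if_pos (Int.natCast_nonneg k), Int.toNat_natCast]

theorem inVars_completeInt_rec (n : ℕ) (k : ℤ) : inVars K (n + 1) (completeInt K k) =
    inVars K n (completeInt K k) + X n * inVars K (n + 1) (completeInt K (k - 1)) := by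
  rcases lt_or_ge k 0 with hk | hk
  · rw [completeInt_neg K hk, completeInt_neg K (by omega)]; simp
  · obtain ⟨m, rfl⟩ := Int.eq_ofNat_of_zero_le hk
    cases m with
    | zero => simp [completeInt, complete_zero]
    | succ m =>
      rw [show ((m + 1 : ℕ) : ℤ) - 1 = (m : ℕ) by push_cast; ring, completeInt_natCast,
        completeInt_natCast, inVars_complete_eq, inVars_complete_eq, branchAux]

/-- In the variables `x_0, …, x_{n-1}`, the Schur function `s_l` is the Schur polynomial: the
generating function of the semistandard tableaux of shape `l`. -/
theorem inVars_schur (n : ℕ) (l : YoungDiagram) : inVars K n (schur K l) = schurPoly K n l := by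
  have hdet : ∀ n l, inVars K n (schur K l) =
      jtDet (fun k => inVars K n (completeInt K k)) (l.colLen 0) l.rowLen := by
    intro n l
    rw [schur, AlgHom.map_det, jtDet]
    rfl
  have h0 : ∀ n, inVars K n (completeInt K 0) = 1 := by
    intro n; simp [completeInt, complete_zero]
  have hneg : ∀ n, ∀ k < 0, inVars K n (completeInt K k) = 0 := by
    intro n k hk; rw [completeInt_neg K hk, map_zero]
  induction n generalizing l with
  | zero =>
    rw [hdet, schurPoly_zero]
    have hz : ∀ k : ℤ, k ≠ 0 → inVars K 0 (completeInt K k) = 0 := by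
      intro k hk
      rcases lt_or_ge k 0 with hk' | hk'
      · exact hneg 0 k hk'
      · obtain ⟨m, rfl⟩ := Int.eq_ofNat_of_zero_le hk'
        obtain ⟨m, rfl⟩ : ∃ j, m = j + 1 := ⟨m - 1, by omega⟩
        have h1 := inVars_newton K 0 m
        simp only [Finset.range_zero, Finset.sum_empty, zero_mul, Finset.sum_const_zero] at h1
        have h2 : ((m + 1 : ℚ)) ≠ 0 := by positivity
        have := congrArg (fun x => ((m + 1 : ℚ)⁻¹) • x) h1
        rw [completeInt_natCast]
        simpa [smul_smul, inv_mul_cancel₀ h2] using this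
    rw [jtDet, Matrix.det_of_isLowerTriangular]
    · split_ifs with h
      · refine Finset.prod_eq_one fun i _ => ?_
        rw [card_eq_sum, Finset.sum_eq_zero_iff] at h
        simp [h i (Finset.mem_univ i), h0]
      · rw [card_eq_sum, Finset.sum_eq_zero_iff] at h
        push Not at h
        obtain ⟨i, hi, hi'⟩ := h
        refine Finset.prod_eq_zero hi ?_
        rw [Matrix.of_apply, hz]
        simpa using hi'
    · intro i j hij
      have hij' : (i : ℕ) < j := hij
      rw [Matrix.of_apply, hz]
      omega
  | succ n ih =>
    rw [hdet, schurPoly_succ, jtDet_strips (h0 n) (hneg n) (inVars_completeInt_rec K n)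
      (hneg (n + 1))]
    refine Finset.sum_congr rfl fun k _ => ?_
    rw [← ih, hdet]

end Tableaux

end SymFun

/-! Everything follows from one fact: the generating operator $\sum_r t^r e_r^\perp$ is a ring
homomorphism $\Lambda\to\Lambda[t]$, namely $p_k\mapsto p_k+(-1)^{k+1}t^k$ (`addDualVar`,
`coeff_addDualVar`).

Since it is known on power sums, it can be compared with plethysm there: on $p_k[g]$ it equals
$p_k[\cdot]$ applied to the coefficients of $\sum_i t^i e_i^\perp g$, with $t$ replaced by
$(-1)^{k+1}t^k$ (`addDualVar_powerPleth`). Hence $\sum_r t^r e_r^\perp(f[g])$ is $f$ evaluated at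
$p_k\mapsto\sum_i t^{ik}\,((-1)^{k+1})^i\,p_k[e_i^\perp g]$, that is, at a sum of alphabets indexed
by $i$ (`addDualVar_pleth`). A Schur function of a sum of alphabets expands as $\sum\langle
s_\lambda,\prod s_{\nu^{(i)}}\rangle\prod s_{\nu^{(i)}}(A_i)$ (`aeval_sum_eq`). In alphabet $i$ the
sign produces $\omega^i$, and homogeneity produces $t^{i|\nu^{(i)}|}$ (`aeval_signed_schur`). The
coefficient of $t^r$ is the formula. The index stops at $\min(r,\ell(\mu))$ because $e_i^\perp
s_\mu=0$ for $i>\ell(\mu)$ and alphabets with $i>r$ vanish modulo $t^{r+1}$.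

The Hall form is defined by orthonormality of Schur functions, so its compatibility with the
coproduct has to be proved. It is identified with the form for which power sum monomials are
orthogonal (`hall_eq_pairing`); for that form $p_k$ is adjoint to $k\,\partial/\partial p_k$, and
the product is dual to the coproduct (`pairing_mul`). Orthonormality of the $s_\lambda$ for it comes
from the Jacobi–Trudi determinant: branching gives the dual Pieri rule, hence triangularity against
products of the $h_n$, measured by the sum of squares of the parts.

Finally $\omega s_\lambda=s_{\lambda'}$ holds because $\omega$ exchanges the operators $h_n^\perp$
and $e_n^\perp$, which remove horizontal and vertical strips (`omega_schur`). -/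

namespace SymFun

open MvPolynomial
open scoped TensorProduct Polynomial

/-! ### The pairing for which power sum monomials are orthogonal -/

section Pairing

variable (K : Type*) [CommRing K]

/-- The number `z_m = ∏_k k^{m_k} m_k!`. -/
noncomputable def zNumber (m : ℕ+ →₀ ℕ) : ℕ := m.prod fun k c => (k : ℕ) ^ c * c.factorial

theorem zNumber_add_single (m : ℕ+ →₀ ℕ) (k : ℕ+) :
    zNumber (m + Finsupp.single k 1) = zNumber m * (k * (m k + 1)) := by
  classical
  have h : ∀ m' : ℕ+ →₀ ℕ, zNumber m' =
      (k : ℕ) ^ m' k * (m' k).factorial *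
        (m'.erase k).prod fun k c => (k : ℕ) ^ c * c.factorial := by
    intro m'
    exact (Finsupp.mul_prod_erase' m' k (fun k c => (k : ℕ) ^ c * c.factorial) (by simp)).symm
  rw [h, h m, Finsupp.erase_add, Finsupp.erase_single, add_zero]
  simp only [Finsupp.add_apply, Finsupp.single_eq_same, pow_succ, Nat.factorial_succ]
  ring

/-- The bilinear form with `⟨p_m, p_m'⟩ = z_m δ_{m m'}` on monomials in the power sums. -/
noncomputable def pairing : LinearMap.BilinForm K (Sym K) :=
  (basisMonomials ℕ+ K).constr K fun m => (zNumber m : K) • lcoeff K m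

theorem pairing_monomial (m : ℕ+ →₀ ℕ) (c : K) (g : Sym K) :
    pairing K (monomial m c) g = c * (zNumber m * coeff m g) := by
  have h : monomial m c = c • basisMonomials ℕ+ K m := by
    rw [coe_basisMonomials, smul_monomial, smul_eq_mul, mul_one]
  rw [h, map_smul, pairing, Module.Basis.constr_basis]
  simp

theorem pairing_comm (f g : Sym K) : pairing K f g = pairing K g f := by
  classical
  have h : pairing K = LinearMap.flip (pairing K) := by
    refine (basisMonomials ℕ+ K).ext fun m => (basisMonomials ℕ+ K).ext fun m' => ?_
    rw [LinearMap.flip_apply, coe_basisMonomials, pairing_monomial, pairing_monomial,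
      coeff_monomial, coeff_monomial]
    by_cases h : m = m'
    · subst h; rfl
    · rw [if_neg h, if_neg (Ne.symm h)]; simp
  exact LinearMap.congr_fun (LinearMap.congr_fun h f) g

theorem pairing_one (g : Sym K) : pairing K 1 g = constantCoeff g := by
  rw [← C_1, C_apply, pairing_monomial]
  simp [zNumber, constantCoeff_eq]

/-- The adjoint `k ∂/∂p_k` of multiplication by `p_k`. -/
noncomputable def powerDer (k : ℕ+) : Sym K →ₗ[K] Sym K :=
  (k : K) • (pderiv k : Derivation K (Sym K) (Sym K)).toLinearMap

theorem powerDer_apply (k : ℕ+) (f : Sym K) : powerDer K k f = (k : K) • pderiv k f := rfl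

theorem powerDer_X_mul (j k : ℕ+) (f : Sym K) : powerDer K k (X j * f) =
    X j * powerDer K k f + powerDer K k (X j) * f := by
  simp only [powerDer_apply, Derivation.leibniz, smul_eq_mul, smul_add]
  rw [mul_smul_comm, mul_comm f, smul_mul_assoc]

theorem powerDer_X [DecidableEq ℕ+] (j k : ℕ+) :
    powerDer K k (X j) = if j = k then C (k : K) else 0 := by
  rw [powerDer_apply, pderiv_X, Pi.single_apply]
  split_ifs
  · rw [smul_eq_C_mul, mul_one]
  · simp

/-- On a monomial $p_m$, the factor $k(m_k+1)$ gained by $z_m$ is exactly the factor that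
$k\,\partial/\partial p_k$ produces on the coefficient at $m+k$. -/
theorem pairing_X_mul (k : ℕ+) (f g : Sym K) :
    pairing K (X k * f) g = pairing K f (powerDer K k g) := by
  induction f using MvPolynomial.induction_on' with
  | add p q hp hq => rw [mul_add, map_add, map_add, LinearMap.add_apply, LinearMap.add_apply,
      hp, hq]
  | monomial m c =>
    rw [X, monomial_mul, one_mul, add_comm, pairing_monomial, pairing_monomial, powerDer_apply,
      coeff_smul, coeff_pderiv, zNumber_add_single, smul_eq_mul]
    push_cast
    ring

end Pairing

/-! ### Convolution of homomorphisms and the coproduct -/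

section Convolution

variable {K : Type*} [CommRing K] {A : Type*} [CommRing A] [Algebra K A]
  {B : Type*} [CommRing B] [Algebra K B]

/-- The evaluation of symmetric functions at the sum of two alphabets. -/
noncomputable def conv (φ ψ : Sym K →ₐ[K] A) : Sym K →ₐ[K] A :=
  aeval fun k => φ (X k) + ψ (X k)

theorem conv_X (φ ψ : Sym K →ₐ[K] A) (k : ℕ+) : conv φ ψ (X k) = φ (X k) + ψ (X k) := by
  simp [conv]

variable (K) in
/-- The coproduct of `Λ`. -/
noncomputable def comul : Sym K →ₐ[K] Sym K ⊗[K] Sym K :=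
  conv Algebra.TensorProduct.includeLeft Algebra.TensorProduct.includeRight

/-- Every convolution factors through the coproduct, so expanding `comul K f` once expands them all.
-/
theorem conv_eq_lift (φ ψ : Sym K →ₐ[K] A) (f : Sym K) :
    conv φ ψ f = Algebra.TensorProduct.lift φ ψ (fun _ _ => Commute.all _ _) (comul K f) := by
  have h : conv φ ψ = (Algebra.TensorProduct.lift φ ψ (fun _ _ => Commute.all _ _)).comp
      (comul K) := by
    ext k; simp [comul, conv]
  rw [h]; rfl

/-- The functional `x ⊗ y ↦ a x * b y`. -/
noncomputable def tensorForm (a b : Sym K →ₗ[K] K) : Sym K ⊗[K] Sym K →ₗ[K] K :=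
  LinearMap.mul' K K ∘ₗ TensorProduct.map a b

@[simp] theorem tensorForm_tmul (a b : Sym K →ₗ[K] K) (x y : Sym K) :
    tensorForm a b (x ⊗ₜ y) = a x * b y := by simp [tensorForm]

/-- Both sides obey the same Leibniz rule along `comul`, and on $p_j$ both give a constant, since
$p_j\otimes1+1\otimes p_j$ depends on $p_j$ in the left factor through one term only. This lets
`pairing_mul` remove a factor $p_k$ by induction. -/
theorem comul_powerDer (k : ℕ+) (f : Sym K) :
    comul K (powerDer K k f) = (powerDer K k).rTensor (Sym K) (comul K f) := by
  classical
  induction f using MvPolynomial.induction_on with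
  | C c =>
    have h : (C c : Sym K) = c • 1 := by rw [smul_eq_C_mul, mul_one]
    have h1 : powerDer K k (1 : Sym K) = 0 := by simp [powerDer_apply]
    rw [h, map_smul, h1, map_smul, map_smul, map_one, Algebra.TensorProduct.one_def,
      map_zero, smul_zero, map_smul, LinearMap.rTensor_tmul, h1, TensorProduct.zero_tmul,
      smul_zero]
  | add p q hp hq => simp only [map_add, hp, hq]
  | mul_X p j hp =>
    have hX : comul K (X j) = X j ⊗ₜ 1 + 1 ⊗ₜ X j := by simp [comul, conv]
    have key : ∀ t : Sym K ⊗[K] Sym K, (powerDer K k).rTensor (Sym K)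
        ((X j ⊗ₜ 1 + 1 ⊗ₜ X j) * t) = (powerDer K k (X j) ⊗ₜ 1) * t +
          (X j ⊗ₜ 1 + 1 ⊗ₜ X j) * (powerDer K k).rTensor (Sym K) t := by
      intro t
      induction t with
      | zero => simp
      | add x y hx hy => rw [mul_add, map_add, hx, hy, map_add]; ring
      | tmul x y =>
        simp only [add_mul, Algebra.TensorProduct.tmul_mul_tmul, one_mul, map_add,
          LinearMap.rTensor_tmul, powerDer_X_mul, TensorProduct.add_tmul]
        ring
    have hD : comul K (powerDer K k (X j)) = powerDer K k (X j) ⊗ₜ 1 := by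
      rw [powerDer_X]
      split_ifs
      · have h : (C (k : K) : Sym K) = (k : K) • 1 := by rw [smul_eq_C_mul, mul_one]
        rw [h, map_smul, map_one, Algebra.TensorProduct.one_def, TensorProduct.smul_tmul']
      · simp
    rw [mul_comm p, powerDer_X_mul, map_add, map_mul, map_mul, map_mul, hp, hX, key, hD]
    ring

/-- The product is dual to the coproduct. -/
theorem pairing_mul (f g h : Sym K) :
    pairing K f (g * h) = tensorForm (pairing K g) (pairing K h) (comul K f) := by
  induction g using MvPolynomial.induction_on generalizing f h with
  | C c =>
    -- Pairing with 1 is the constant term, which is the counit; convolving the counit with the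
    -- identity gives the identity.
    have h0 : tensorForm (pairing K (1 : Sym K)) (pairing K h) ∘ₗ (comul K).toLinearMap =
        pairing K h := by
      have h1 : (pairing K h).comp ((Algebra.TensorProduct.lift
          (aeval (fun _ => 0) : Sym K →ₐ[K] Sym K) (AlgHom.id K (Sym K))
          (fun _ _ => Commute.all _ _)).toLinearMap) =
          tensorForm (pairing K (1 : Sym K)) (pairing K h) := by
        refine TensorProduct.ext' fun x y => ?_
        simp only [LinearMap.comp_apply, AlgHom.toLinearMap_apply,
          Algebra.TensorProduct.lift_tmul, tensorForm_tmul, pairing_one]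
        rw [show (aeval fun _ => (0 : Sym K)) x = C (constantCoeff x) by
            rw [← algebraMap_eq, ← MvPolynomial.aeval_zero]; rfl, ← smul_eq_C_mul, map_smul]
        simp
      rw [← h1]
      refine LinearMap.ext fun f => ?_
      simp only [LinearMap.comp_apply, AlgHom.toLinearMap_apply]
      rw [← conv_eq_lift]
      congr 1
      have : conv (aeval (fun _ => 0) : Sym K →ₐ[K] Sym K) (AlgHom.id K (Sym K)) =
        AlgHom.id K (Sym K) := by ext k; simp [conv]
      rw [this]; rfl
    have hC : (C c : Sym K) = c • 1 := by rw [smul_eq_C_mul, mul_one]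
    have h2 := LinearMap.congr_fun h0 f
    simp only [LinearMap.comp_apply, AlgHom.toLinearMap_apply] at h2
    have h3 : tensorForm (pairing K (c • 1 : Sym K)) (pairing K h) =
        c • tensorForm (pairing K (1 : Sym K)) (pairing K h) := by
      exact TensorProduct.ext' fun x y => by simp [mul_assoc]
    rw [hC, h3, LinearMap.smul_apply, h2, smul_mul_assoc, one_mul, map_smul, pairing_comm]
  | add p q hp hq =>
    have h3 : tensorForm (pairing K (p + q)) (pairing K h) =
        tensorForm (pairing K p) (pairing K h) + tensorForm (pairing K q) (pairing K h) := by
      exact TensorProduct.ext' fun x y => by simp [add_mul]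
    rw [add_mul, map_add, hp, hq, h3, LinearMap.add_apply]
  | mul_X p k hp =>
    have h3 : tensorForm (pairing K (X k * p)) (pairing K h) =
        tensorForm (pairing K p) (pairing K h) ∘ₗ (powerDer K k).rTensor (Sym K) := by
      exact TensorProduct.ext' fun x y => by simp [pairing_X_mul]
    rw [mul_comm p, h3, mul_assoc, pairing_comm, pairing_X_mul, pairing_comm, hp, comul_powerDer]
    rfl

end Convolution

/-! ### Generating series of the complete symmetric functions -/

section Newton

variable {K : Type*} [CommRing K] [Algebra ℚ K] {A : Type*} [CommRing A] [Algebra K A]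

theorem isUnit_natCast_succ (K : Type*) [CommRing K] [Algebra ℚ K] {A : Type*} [CommRing A]
    [Algebra K A] (n : ℕ) : IsUnit ((n : A) + 1) := by
  have h : IsUnit ((n : ℚ) + 1) := IsUnit.mk0 _ (by positivity)
  simpa using (h.map (algebraMap ℚ K)).map (algebraMap K A)

theorem map_complete_succ (φ : Sym K →ₐ[K] A) (n : ℕ) : ((n : A) + 1) * φ (complete K (n + 1)) =
    ∑ i ∈ Finset.range (n + 1), φ (X (Nat.succPNat i)) * φ (complete K (n - i)) := by
  have h := congrArg φ (complete_succ K n)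
  rw [← algebraMap_smul K ((n : ℚ) + 1), map_smul, map_sum, Algebra.smul_def] at h
  simpa using h

/-- A sequence that satisfies the Newton recursion is the sequence of values of the complete
symmetric functions. -/
theorem map_complete_of_newton (φ : Sym K →ₐ[K] A) (a : ℕ → A) (h0 : a 0 = 1)
    (h : ∀ n : ℕ, ((n : A) + 1) * a (n + 1) =
      ∑ i ∈ Finset.range (n + 1), φ (X (Nat.succPNat i)) * a (n - i)) (n : ℕ) :
    φ (complete K n) = a n := by
  induction n using Nat.strong_induction_on with
  | _ n ih =>
    cases n with
    | zero => rw [complete_zero, map_one, h0]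
    | succ n =>
      refine (isUnit_natCast_succ K n).mul_left_cancel ?_
      rw [map_complete_succ, h]
      exact Finset.sum_congr rfl fun i _ => by rw [ih (n - i) (by omega)]

/-- The generating series of the values of the power sums. -/
noncomputable def powerSeries (φ : Sym K →ₐ[K] A) : PowerSeries A :=
  PowerSeries.mk fun i => φ (X (Nat.succPNat i))

/-- The generating series of the values of the complete symmetric functions. -/
noncomputable def completeSeries (φ : Sym K →ₐ[K] A) : PowerSeries A :=
  PowerSeries.mk fun n => φ (complete K n)

/-- Newton's recursion is the differential equation $F'=PF$ read coefficientwise. -/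
theorem derivative_eq_mul_iff (φ : Sym K →ₐ[K] A) (F : PowerSeries A) :
    PowerSeries.derivative A F = powerSeries φ * F ↔ ∀ n : ℕ,
      ((n : A) + 1) * PowerSeries.coeff (n + 1) F =
        ∑ i ∈ Finset.range (n + 1), φ (X (Nat.succPNat i)) * PowerSeries.coeff (n - i) F := by
  rw [PowerSeries.ext_iff]
  refine forall_congr' fun n => ?_
  rw [PowerSeries.coeff_derivative, PowerSeries.coeff_mul,
    Finset.Nat.sum_antidiagonal_eq_sum_range_succ_mk, mul_comm]
  simp [powerSeries]

theorem derivative_completeSeries (φ : Sym K →ₐ[K] A) :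
    PowerSeries.derivative A (completeSeries φ) = powerSeries φ * completeSeries φ := by
  rw [derivative_eq_mul_iff]
  intro n
  simpa [completeSeries] using map_complete_succ φ n

/-- The series of power sums add under `conv`. By the Leibniz rule the product of the two series of
complete functions then solves $F'=PF$ for the sum, and the recursion has only one solution because
every $n+1$ is invertible. -/
theorem conv_complete (φ ψ : Sym K →ₐ[K] A) (n : ℕ) : conv φ ψ (complete K n) =
    ∑ p ∈ Finset.HasAntidiagonal.antidiagonal n, φ (complete K p.1) * ψ (complete K p.2) := by
  have h := map_complete_of_newton (conv φ ψ)
    (fun n => PowerSeries.coeff n (completeSeries φ * completeSeries ψ))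
    (by simp [completeSeries, complete_zero]) ((derivative_eq_mul_iff _ _).1 ?_) n
  · rw [h, PowerSeries.coeff_mul]
    simp [completeSeries]
  · have hP : powerSeries (conv φ ψ) = powerSeries φ + powerSeries ψ := by
      ext n; simp [powerSeries, conv_X]
    rw [Derivation.leibniz, derivative_completeSeries, derivative_completeSeries, hP]
    simp only [smul_eq_mul]
    ring

variable (K) in
/-- The evaluation at one variable: `p_k ↦ t^k`. -/
noncomputable def oneVar (t : A) : Sym K →ₐ[K] A := aeval fun k : ℕ+ => t ^ (k : ℕ)

theorem oneVar_complete (t : A) (n : ℕ) : oneVar K t (complete K n) = t ^ n := by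
  refine map_complete_of_newton _ _ (pow_zero t) (fun n => ?_) n
  have h : ∀ i ∈ Finset.range (n + 1),
      oneVar K t (X (Nat.succPNat i)) * t ^ (n - i) = t ^ (n + 1) := by
    intro i hi
    have hi := Finset.mem_range.1 hi
    rw [oneVar, aeval_X, Nat.succPNat_coe, ← pow_add]
    congr 1; omega
  rw [Finset.sum_congr rfl h]
  simp

variable (K) in
/-- The evaluation at one negated variable: `p_k ↦ (-1)^{k-1} t^k`. -/
noncomputable def dualVar (t : A) : Sym K →ₐ[K] A :=
  aeval fun k : ℕ+ => (-1) ^ ((k : ℕ) + 1) * t ^ (k : ℕ)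

theorem dualVar_complete (t : A) (n : ℕ) :
    dualVar K t (complete K n) = if n = 0 then 1 else if n = 1 then t else 0 := by
  refine map_complete_of_newton _ (fun n => if n = 0 then 1 else if n = 1 then t else 0)
    (if_pos rfl) (fun n => ?_) n
  cases n with
  | zero => simp [dualVar]
  | succ n =>
    -- Only the terms containing $h_1$ and $h_0$ survive; their signs are opposite and they cancel.
    rw [Finset.sum_eq_add_of_mem n (n + 1) (by simp) (by simp) (by omega)]
    · simp [dualVar, pow_succ]
      ring
    · intro i hi hne
      have hi := Finset.mem_range.1 hi
      simp only [if_neg (show n + 1 - i ≠ 0 by omega), if_neg (show n + 1 - i ≠ 1 by omega),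
        mul_zero]

/-- Adding a variable divides the generating series by $1-tz$. This is the recursion required by
`jtDet_strips`. -/
theorem conv_oneVar_completeInt (t : A) (ψ : Sym K →ₐ[K] A) (k : ℤ) :
    conv (oneVar K t) ψ (completeInt K k) =
      ψ (completeInt K k) + t * conv (oneVar K t) ψ (completeInt K (k - 1)) := by
  rcases lt_or_ge k 0 with hk | hk
  · rw [completeInt_neg K hk, completeInt_neg K (by omega)]; simp
  · obtain ⟨m, rfl⟩ := Int.eq_ofNat_of_zero_le hk
    cases m with
    | zero => simp [completeInt, complete_zero]
    | succ m =>
      rw [show ((m + 1 : ℕ) : ℤ) - 1 = (m : ℕ) by push_cast; ring, completeInt_natCast,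
        completeInt_natCast, conv_complete, conv_complete, Finset.Nat.antidiagonal_succ,
        Finset.sum_cons, Finset.sum_map, Finset.mul_sum]
      simp only [oneVar_complete, pow_zero, one_mul]
      congr 1
      refine Finset.sum_congr rfl fun p _ => ?_
      simp [pow_succ]
      ring

/-- Adding a negated variable multiplies the generating series by $1+tz$. This is the recursion
required by `jtDet_verticalStrips`. -/
theorem conv_dualVar_completeInt (t : A) (ψ : Sym K →ₐ[K] A) (k : ℤ) :
    conv (dualVar K t) ψ (completeInt K k) =
      ψ (completeInt K k) + t * ψ (completeInt K (k - 1)) := by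
  rcases lt_or_ge k 0 with hk | hk
  · rw [completeInt_neg K hk, completeInt_neg K (by omega)]; simp
  · obtain ⟨m, rfl⟩ := Int.eq_ofNat_of_zero_le hk
    cases m with
    | zero => simp [completeInt, complete_zero]
    | succ m =>
      rw [show ((m + 1 : ℕ) : ℤ) - 1 = (m : ℕ) by push_cast; ring, completeInt_natCast,
        completeInt_natCast, conv_complete, Finset.Nat.sum_antidiagonal_eq_sum_range_succ_mk,
        Finset.sum_eq_add_of_mem 0 1 (by simp) (by simp) (by omega)]
      · simp [dualVar_complete]
      · intro i _ hi
        simp only [dualVar_complete, if_neg hi.1, if_neg hi.2, zero_mul]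

end Newton

/-! ### Adjoints of multiplication by complete symmetric functions -/

section Adjoint

variable (K : Type*) [CommRing K] [Algebra ℚ K]

theorem comul_complete (n : ℕ) : comul K (complete K n) =
    ∑ p ∈ Finset.HasAntidiagonal.antidiagonal n, complete K p.1 ⊗ₜ complete K p.2 := by
  rw [comul, conv_complete]
  simp

theorem constantCoeff_complete (n : ℕ) :
    constantCoeff (complete K n) = if n = 0 then 1 else 0 := by
  have h : aeval (fun _ => (0 : K)) (complete K n) = constantCoeff (complete K n) := by
    simp
  have h1 : (aeval (fun _ => (0 : K)) : Sym K →ₐ[K] K) = oneVar K (0 : K) := by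
    ext k; simp [oneVar]
  rw [← h, h1, oneVar_complete, zero_pow_eq]

/-- The pairing is the constant term of $k\,\partial h_n/\partial p_k$. In Newton's recursion the
only contribution comes from differentiating $p_k$ itself against a cofactor $h_j$ with nonzero
constant term, that is, $h_0$. -/
theorem pairing_complete_X (n : ℕ) (k : ℕ+) :
    pairing K (complete K n) (X k) = if n = k then 1 else 0 := by
  classical
  rw [pairing_comm, ← mul_one (X k), pairing_X_mul, pairing_one]
  cases n with
  | zero =>
    rw [complete_zero, if_neg k.pos.ne]
    simp [powerDer_apply]
  | succ n =>
    refine (isUnit_natCast_succ K n).mul_left_cancel ?_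
    have h : constantCoeff (powerDer K k (((n : K) + 1) • complete K (n + 1))) =
        ∑ i ∈ Finset.range (n + 1), constantCoeff
          (powerDer K k (X (Nat.succPNat i) * complete K (n - i))) := by
      rw [smul_eq_C_mul]
      have := map_complete_succ (AlgHom.id K (Sym K)) n
      simp only [AlgHom.id_apply] at this
      rw [map_add, map_natCast, map_one, this, map_sum, map_sum]
    rw [map_smul, ← C_mul', map_mul, constantCoeff_C] at h
    rw [h]
    simp only [powerDer_X_mul, map_add, map_mul, constantCoeff_X, zero_mul, zero_add,
      constantCoeff_complete, powerDer_X]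
    by_cases hk : n + 1 = k
    · rw [Finset.sum_eq_single n]
      · rw [if_pos hk, if_pos (PNat.eq (by simpa using hk))]
        simp [← hk]
      · intro i hi hne
        have hi := Finset.mem_range.1 hi
        rw [if_neg (show n - i ≠ 0 by omega), mul_zero]
      · simp
    · rw [if_neg hk, mul_zero]
      refine Finset.sum_eq_zero fun i hi => ?_
      have hi := Finset.mem_range.1 hi
      by_cases hin : i = n
      · subst hin
        rw [if_neg (fun h => hk (by simpa using congrArg PNat.val h))]
        simp
      · rw [if_neg (show n - i ≠ 0 by omega), mul_zero]

/-- Pairing with `h_n` extracts the degree `n` part of the evaluation in one variable. -/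
theorem pairing_complete (n : ℕ) (f : Sym K) : pairing K (complete K n) f =
    (oneVar K (Polynomial.X : K[X]) f).coeff n := by
  let Φ : Sym K →ₗ[K] PowerSeries K :=
    { toFun := fun f => PowerSeries.mk fun n => pairing K (complete K n) f
      map_add' := fun f g => by ext n; simp
      map_smul' := fun c f => by ext n; simp }
  -- Multiplicativity of $f\mapsto\sum_n\langle h_n,f\rangle t^n$ is the coproduct formula for $h_n$
  -- read through `pairing_mul`; it then suffices to compare on power sums.
  let Ψ : Sym K →ₐ[K] PowerSeries K := AlgHom.ofLinearMap Φ
    (by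
      ext n
      simp only [Φ, LinearMap.coe_mk, AddHom.coe_mk, PowerSeries.coeff_mk, PowerSeries.coeff_one]
      rw [pairing_comm, pairing_one, constantCoeff_complete])
    (by
      intro f g
      ext n
      simp only [Φ, LinearMap.coe_mk, AddHom.coe_mk, PowerSeries.coeff_mk, PowerSeries.coeff_mul]
      rw [pairing_mul, comul_complete, map_sum]
      exact Finset.sum_congr rfl fun p _ => by
        rw [tensorForm_tmul, pairing_comm, pairing_comm K g])
  have h : Ψ = (Polynomial.coeToPowerSeries.algHom K).comp (oneVar K (Polynomial.X : K[X])) := by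
    ext k n
    have : PowerSeries.coeff n (Ψ (X k)) = pairing K (complete K n) (X k) := by
      simp [Ψ, Φ]
    rw [this, pairing_complete_X]
    simp [oneVar, PowerSeries.coeff_X_pow]
  have h2 := congrArg (fun χ : Sym K →ₐ[K] PowerSeries K => PowerSeries.coeff n (χ f)) h
  simpa [Ψ, Φ] using h2

/-- The homomorphism `∑_n t^n h_n^⊥`, which adds the variable `t` to the alphabet. -/
noncomputable def addVar : Sym K →ₐ[K] (Sym K)[X] :=
  conv (oneVar K Polynomial.X) Polynomial.CAlgHom

/-- The homomorphism `∑_n t^n e_n^⊥`. -/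
noncomputable def addDualVar : Sym K →ₐ[K] (Sym K)[X] :=
  conv (dualVar K Polynomial.X) Polynomial.CAlgHom

/-- Under the coproduct, the left factor contributes $\langle e,\cdot\rangle$ through the
coefficient of $\varphi$, and the right factor is kept to be paired with $g$. Applied with $e=h_n$
and with $e=s_{1^n}$. -/
theorem pairing_coeff_conv (φ : Sym K →ₐ[K] K[X]) (e : Sym K) (n : ℕ)
    (he : ∀ x, pairing K e x = (φ x).coeff n) (f g : Sym K) :
    pairing K ((conv ((Polynomial.mapAlgHom (Algebra.ofId K (Sym K))).comp φ)
      Polynomial.CAlgHom f).coeff n) g = pairing K f (e * g) := by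
  rw [pairing_mul, conv_eq_lift]
  have h : LinearMap.flip (pairing K) g ∘ₗ (Polynomial.lcoeff (Sym K) n).restrictScalars K ∘ₗ
      (Algebra.TensorProduct.lift ((Polynomial.mapAlgHom (Algebra.ofId K (Sym K))).comp φ)
        Polynomial.CAlgHom (fun _ _ => Commute.all _ _)).toLinearMap =
      tensorForm (pairing K e) (pairing K g) := by
    refine TensorProduct.ext' fun x y => ?_
    have hx : (Polynomial.mapAlgHom (Algebra.ofId K (Sym K))).comp φ x =
        (φ x).map (algebraMap K (Sym K)) := rfl
    simp only [LinearMap.comp_apply, AlgHom.toLinearMap_apply, LinearMap.coe_restrictScalars,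
      Algebra.TensorProduct.lift_tmul, tensorForm_tmul, Polynomial.lcoeff_apply,
      LinearMap.flip_apply, Polynomial.CAlgHom_apply, Polynomial.coeff_mul_C, hx,
      Polynomial.coeff_map, he, algebraMap_eq, ← smul_eq_C_mul, map_smul,
      smul_eq_mul, pairing_comm K y]
  exact LinearMap.congr_fun h (comul K f)

/-- The coefficients of `addVar` are adjoint to multiplication by complete symmetric functions. -/
theorem pairing_addVar (n : ℕ) (f g : Sym K) :
    pairing K ((addVar K f).coeff n) g = pairing K f (complete K n * g) := by
  rw [← pairing_coeff_conv K (oneVar K Polynomial.X) _ n (pairing_complete K n)]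
  have : oneVar K (Polynomial.X : (Sym K)[X]) =
      (Polynomial.mapAlgHom (Algebra.ofId K (Sym K))).comp (oneVar K (Polynomial.X : K[X])) := by
    ext k; simp [oneVar]
  rw [addVar, this]

end Adjoint

/-! ### Horizontal strips and exponent vectors -/

section Strips

theorem expo_eq_sum_range {l : YoungDiagram} {N : ℕ} (h : l.colLen 0 ≤ N) :
    expo l = ∑ i ∈ Finset.range N, unitExpo (l.rowLen i) := by
  rw [expo_eq_sum, ← Finset.sum_range (fun i => unitExpo (l.rowLen i))]
  refine Finset.sum_subset (Finset.range_mono h) fun i _ hi => ?_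
  rw [Finset.mem_range, not_lt] at hi
  simp [rowLen_eq_zero hi, unitExpo]

theorem card_eq_sum_range {l : YoungDiagram} {N : ℕ} (h : l.colLen 0 ≤ N) :
    l.card = ∑ i ∈ Finset.range N, l.rowLen i := by
  rw [card_eq_sum_of_le h, ← Finset.sum_range (fun i => l.rowLen i)]

/-- Moving the cells of a horizontal strip into one new part of size $t$ cannot raise the sum of
squares of the parts, and keeps it only if the multiset of parts is unchanged. The bound `t ≤ a 0`
feeds the induction: the tail's strip size is at most $a_1\le b_0$. -/
theorem interlacing_expo (N : ℕ) (a b : ℕ → ℕ) (h : ∀ i, a (i + 1) ≤ b i ∧ b i ≤ a i)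
    (hN : a N = 0) : ∃ t ≤ a 0,
      ∑ i ∈ Finset.range N, a i = ∑ i ∈ Finset.range N, b i + t ∧
      (∑ i ∈ Finset.range N, unitExpo (a i) = ∑ i ∈ Finset.range N, unitExpo (b i) + unitExpo t ∨
        expoSq (∑ i ∈ Finset.range N, unitExpo (b i) + unitExpo t) <
          expoSq (∑ i ∈ Finset.range N, unitExpo (a i))) := by
  induction N generalizing a b with
  | zero => exact ⟨0, Nat.zero_le _, by simp, Or.inl (by simp [unitExpo])⟩
  | succ N ih =>
    obtain ⟨t, ht, hsum, hor⟩ := ih (fun i => a (i + 1)) (fun i => b (i + 1))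
      (fun i => h (i + 1)) hN
    have h0 := h 0
    simp only [zero_add] at ht h0
    refine ⟨t + (a 0 - b 0), by omega, ?_, ?_⟩
    · rw [Finset.sum_range_succ' a, Finset.sum_range_succ' b]; omega
    · rw [Finset.sum_range_succ' (fun i => unitExpo (a i)),
        Finset.sum_range_succ' (fun i => unitExpo (b i))]
      have hle : expoSq (∑ i ∈ Finset.range N, unitExpo (b (i + 1)) + unitExpo t) ≤
          expoSq (∑ i ∈ Finset.range N, unitExpo (a (i + 1))) := by
        rcases hor with hor | hor
        · exact (congrArg expoSq hor).ge
        · exact hor.le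
      simp only [map_add, expoSq_unit] at hle hor ⊢
      -- The pairs $\{b_0,\,t+a_0-b_0\}$ and $\{a_0,t\}$ have the same sum, and the first lies
      -- between $t$ and $a_0$. Strictly inside, convexity makes its squares smaller; otherwise the
      -- two pairs coincide.
      by_cases hlt : t < b 0 ∧ b 0 < a 0
      · right
        obtain ⟨d, hd⟩ := Nat.exists_eq_add_of_lt hlt.2
        obtain ⟨e, he⟩ := Nat.exists_eq_add_of_lt hlt.1
        rw [show t + (a 0 - b 0) = t + d + 1 by omega]
        nlinarith
      · have hcase : b 0 = a 0 ∨ b 0 = t := by omega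
        have hperm : unitExpo (b 0) + unitExpo (t + (a 0 - b 0)) = unitExpo (a 0) + unitExpo t := by
          rcases hcase with hc | hc
          · rw [hc, Nat.sub_self, add_zero]
          · rw [← hc, Nat.add_sub_cancel' h0.2, add_comm]
        rcases hor with hor | hor
        · left
          rw [hor, add_assoc, add_assoc, hperm, add_comm (unitExpo t)]
        · right
          have := congrArg expoSq hperm
          simp only [map_add, expoSq_unit] at this
          omega

theorem strips_le {l k : YoungDiagram} (h : k ∈ strips l) : k ≤ l :=
  le_of_rowLen fun i => (mem_strips.1 h i).2

theorem expo_strip {l k : YoungDiagram} (h : k ∈ strips l) :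
    expo l = unitExpo (l.card - k.card) + expo k ∨
      (l.card - k.card) ^ 2 + expoSq (expo k) < expoSq (expo l) := by
  have hN : k.colLen 0 ≤ l.colLen 0 := colLen_le_of_rowLen fun i => (mem_strips.1 h i).2
  obtain ⟨t, -, h1, h2⟩ := interlacing_expo (l.colLen 0) l.rowLen k.rowLen (mem_strips.1 h)
    (rowLen_eq_zero le_rfl)
  rw [← card_eq_sum_range le_rfl, ← card_eq_sum_range hN] at h1
  rw [← expo_eq_sum_range le_rfl, ← expo_eq_sum_range hN] at h2
  have ht : l.card - k.card = t := by omega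
  rw [ht]
  simpa only [map_add, expoSq_unit, add_comm] using h2

/-- Removal of the first row. -/
def dropRow (l : YoungDiagram) : YoungDiagram :=
  ofRows (l.colLen 0) (fun i => l.rowLen (i + 1)) fun _ _ h =>
    l.rowLen_anti _ _ (Nat.add_le_add_right h 1)

theorem rowLen_dropRow (l : YoungDiagram) (i : ℕ) : (dropRow l).rowLen i = l.rowLen (i + 1) := by
  refine (rowLen_ofRows _ _ _ i).trans ?_
  split_ifs with h
  · rfl
  · exact (rowLen_eq_zero (by omega)).symm

theorem dropRow_mem_strips (l : YoungDiagram) : dropRow l ∈ strips l :=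
  mem_strips.2 fun i => by
    rw [rowLen_dropRow]
    exact ⟨le_rfl, l.rowLen_anti _ _ (Nat.le_succ i)⟩

theorem expo_dropRow (l : YoungDiagram) :
    expo l = unitExpo (l.rowLen 0) + expo (dropRow l) := by
  have hN : (dropRow l).colLen 0 ≤ l.colLen 0 :=
    colLen_le_of_rowLen fun i => (mem_strips.1 (dropRow_mem_strips l) i).2
  rw [expo_eq_sum_range (Nat.le_succ (l.colLen 0)), expo_eq_sum_range hN,
    Finset.sum_range_succ', add_comm]
  simp only [rowLen_dropRow]

theorem card_dropRow (l : YoungDiagram) : l.card = l.rowLen 0 + (dropRow l).card := by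
  rw [← expoWt_expo, expo_dropRow, map_add, expoWt_unit, expoWt_expo]

theorem rowLen_zero_pos {l : YoungDiagram} (h : l.card ≠ 0) : 0 < l.rowLen 0 := by
  by_contra h0
  refine h ?_
  rw [card_eq_sum]
  refine Finset.sum_eq_zero fun i _ => ?_
  have := l.rowLen_anti 0 i (Nat.zero_le _)
  omega

theorem card_eq_zero_iff {l : YoungDiagram} : l.card = 0 ↔ l = ⊥ := by
  constructor
  · intro h
    exact YoungDiagram.ext (by simpa using Finset.card_eq_zero.1 h)
  · rintro rfl; rfl

end Strips

/-! ### Orthonormality of the Schur functions -/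

section Orthonormal

variable (K : Type*) [CommRing K] [Algebra ℚ K]

theorem map_schur {A : Type*} [CommRing A] [Algebra K A] (φ : Sym K →ₐ[K] A) (l : YoungDiagram) :
    φ (schur K l) = jtDet (fun k => φ (completeInt K k)) (l.colLen 0) l.rowLen := by
  rw [schur, AlgHom.map_det]; rfl

theorem schur_bot : schur K ⊥ = 1 := by
  have : (⊥ : YoungDiagram).colLen 0 = 0 := by
    by_contra h
    exact YoungDiagram.notMem_bot _ (YoungDiagram.mem_iff_lt_colLen.2 (Nat.pos_of_ne_zero h))
  rw [← AlgHom.id_apply (R := K) (schur K ⊥), map_schur, this, jtDet, Matrix.det_fin_zero]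

theorem addVar_schur (l : YoungDiagram) : addVar K (schur K l) =
    ∑ k ∈ strips l, Polynomial.X ^ (l.card - k.card) * Polynomial.C (schur K k) := by
  rw [map_schur, jtDet_strips (h := fun k => Polynomial.CAlgHom (R := K) (completeInt K k))
    (t := Polynomial.X)]
  · refine Finset.sum_congr rfl fun k _ => ?_
    rw [← map_schur]; rfl
  · simp [completeInt, complete_zero]
  · intro k hk; rw [completeInt_neg K hk, map_zero]
  · exact conv_oneVar_completeInt _ _
  · intro k hk; rw [completeInt_neg K hk, map_zero]

/-- The Pieri rule in dual form: $h_n^\perp$ removes horizontal strips of size $n$. -/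
theorem pairing_schur_complete_mul (l : YoungDiagram) (n : ℕ) (g : Sym K) :
    pairing K (schur K l) (complete K n * g) =
      ∑ k ∈ (strips l).filter (fun k => l.card - k.card = n), pairing K (schur K k) g := by
  rw [← pairing_addVar, addVar_schur, Polynomial.finsetSum_coeff, map_sum, LinearMap.sum_apply,
    Finset.sum_filter]
  refine Finset.sum_congr rfl fun k _ => ?_
  rw [Polynomial.coeff_mul_C, Polynomial.coeff_X_pow]
  split_ifs with h1 h2 h2
  · rw [one_mul]
  · exact absurd h1.symm h2
  · exact absurd h2.symm h1
  · simp

theorem toComplete_unitExpo_add (n : ℕ) (m : ℕ+ →₀ ℕ) :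
    toComplete K (monomial (unitExpo n + m) 1) =
      complete K n * toComplete K (monomial m 1) := by
  have h := toComplete_varInt K n
  rw [varInt, if_pos (Int.natCast_nonneg n), Int.toNat_natCast, completeInt_natCast] at h
  rw [← h, ← map_mul, monomial_mul, one_mul]

theorem pairing_schur_one [DecidableEq YoungDiagram] (l : YoungDiagram) :
    pairing K (schur K l) 1 = if l = ⊥ then 1 else 0 := by
  split_ifs with h
  · rw [h, schur_bot, pairing_one, map_one]
  · rw [pairing_comm, pairing_one, constantCoeff_eq]
    by_contra hne
    have h1 := isWeightedHomogeneous_schur K l hne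
    rw [map_zero] at h1
    exact h (card_eq_zero_iff.1 h1.symm)

/-- Triangularity of the pairing of Schur functions with products of complete symmetric
functions. -/
theorem pairing_schur_toComplete [DecidableEq YoungDiagram] (l m : YoungDiagram)
    (h : expoSq (expo l) ≤ expoSq (expo m)) :
    pairing K (schur K l) (toComplete K (monomial (expo m) 1)) = if l = m then 1 else 0 := by
  induction hc : m.card using Nat.strong_induction_on generalizing l m with
  | _ c ih =>
    by_cases h0 : m.card = 0
    · rw [card_eq_zero_iff.1 h0]
      have hbot : expo ⊥ = 0 := by
        rw [expo_eq_sum, Finset.sum_eq_zero]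
        intro i _
        exact absurd (YoungDiagram.mem_iff_lt_colLen.2 i.2) (YoungDiagram.notMem_bot _)
      rw [hbot, show (monomial 0 (1 : K) : Sym K) = 1 from rfl, map_one, pairing_schur_one]
    · have hpos := rowLen_zero_pos h0
      have hcard := card_dropRow m
      rw [expo_dropRow m, map_add, expoSq_unit] at h
      -- The factor $h_{m_0}$ of the first row is moved across by the Pieri rule; the rest belongs
      -- to the smaller diagram `dropRow m`.
      rw [expo_dropRow, toComplete_unitExpo_add, pairing_schur_complete_mul]
      have hterm : ∀ k ∈ (strips l).filter (fun k => l.card - k.card = m.rowLen 0),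
          pairing K (schur K k) (toComplete K (monomial (expo (dropRow m)) 1)) =
            if k = dropRow m then 1 else 0 := by
        intro k hk
        rw [Finset.mem_filter] at hk
        -- The inequality is inherited: removing a strip of size $m_0$ lowers the sum of squares by
        -- at least $m_0^2$, and dropping the first row of $m$ lowers it by exactly that.
        refine ih (dropRow m).card (by omega) k (dropRow m) ?_ rfl
        rcases expo_strip hk.1 with h1 | h1
        · rw [h1, map_add, hk.2, expoSq_unit] at h; omega
        · rw [hk.2] at h1; omega
      rw [Finset.sum_congr rfl hterm, Finset.sum_ite_eq']
      refine if_congr ?_ rfl rfl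
      rw [Finset.mem_filter]
      constructor
      -- The strict alternative of `expo_strip` contradicts `h`; in the other, $l$ and $m$ have the
      -- same parts.
      · rintro ⟨h1, h2⟩
        rcases expo_strip h1 with h3 | h3
        · rw [h2, ← expo_dropRow] at h3
          exact expo_bijective.1 h3
        · rw [h2] at h3; omega
      · rintro rfl
        exact ⟨dropRow_mem_strips l, by omega⟩

/-- By symmetry $l$ may be taken to have the smaller sum of squares. Then $s_m$ is $h_m$ plus
products $h_{m'}$ of strictly larger sum of squares, and triangularity kills all of the latter. -/
theorem pairing_schur_schur [DecidableEq YoungDiagram] (l m : YoungDiagram) :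
    pairing K (schur K l) (schur K m) = if l = m then 1 else 0 := by
  wlog h : expoSq (expo l) ≤ expoSq (expo m) generalizing l m
  · rw [pairing_comm, this m l (le_of_not_ge h)]
    exact if_congr eq_comm rfl rfl
  obtain ⟨R, hR, hsupp⟩ := jacobiTrudi_triangular K m
  have h1 : schur K m = toComplete K (monomial (expo m) 1) + toComplete K R := by
    rw [← completeEquiv_jacobiTrudi, hR, map_add]; rfl
  rw [h1, map_add, pairing_schur_toComplete K l m h, R.as_sum, map_sum, map_sum,
    Finset.sum_eq_zero, add_zero]
  intro e he
  obtain ⟨m', rfl⟩ := expo_bijective.2 e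
  have h2 := (hsupp _ he).2
  have h3 : monomial (expo m') (coeff (expo m') R) =
      coeff (expo m') R • monomial (expo m') (1 : K) := by
    rw [smul_monomial, smul_eq_mul, mul_one]
  rw [h3, map_smul, map_smul, pairing_schur_toComplete K l m' (h.trans h2.le), if_neg, smul_zero]
  rintro rfl
  exact absurd h2 (not_lt.2 h)

/-- The bridge between the definition by Schur functions and the computations with power sums: from
here on $f^\perp$ can be read off the coproduct. -/
theorem hall_eq_pairing : hall K = pairing K := by
  classical
  refine (schurBasis K).ext fun l => (schurBasis K).ext fun m => ?_
  rw [schurBasis_apply, schurBasis_apply, hall_schur, pairing_schur_schur]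

end Orthonormal

/-! ### Expansion of convolutions in the Schur basis -/

section Expansion

variable {K : Type*} [CommRing K] [Algebra ℚ K] {A : Type*} [CommRing A] [Algebra K A]

theorem hall_comm (f g : Sym K) : hall K f g = hall K g f := by
  rw [hall_eq_pairing, pairing_comm]

theorem hall_schur_left (l : YoungDiagram) (f : Sym K) :
    hall K (schur K l) f = (schurBasis K).repr f l := by
  rw [← schurBasis_apply, hall, Module.Basis.constr_basis, Module.Basis.coord_apply]

theorem eq_of_hall {f g : Sym K} (h : ∀ l, hall K f (schur K l) = hall K g (schur K l)) :
    f = g := by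
  refine (schurBasis K).repr.injective (Finsupp.ext fun l => ?_)
  rw [← hall_schur_left, ← hall_schur_left, hall_comm, h, hall_comm]

theorem hall_eq_zero {f g : Sym K} {d e : ℕ} (hf : IsWeightedHomogeneous degWeight f d)
    (hg : IsWeightedHomogeneous degWeight g e) (hde : d ≠ e) : hall K f g = 0 := by
  rw [hall_eq_pairing, f.as_sum, map_sum, LinearMap.sum_apply]
  refine Finset.sum_eq_zero fun m hm => ?_
  rw [pairing_monomial]
  by_cases h : coeff m g = 0
  · rw [h, mul_zero, mul_zero]
  · exact absurd ((hf (mem_support_iff.1 hm)).symm.trans (hg h)) hde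

theorem perp_one (g : Sym K) : perp K 1 g = g :=
  eq_of_hall fun l => by rw [hall_perp, one_mul]

theorem tensor_ext {s t : Sym K ⊗[K] Sym K} (h : ∀ l m,
    tensorForm (hall K (schur K l)) (hall K (schur K m)) s =
      tensorForm (hall K (schur K l)) (hall K (schur K m)) t) : s = t := by
  let b := (schurBasis K).tensorProduct (schurBasis K)
  have hb : ∀ l m, (b.coord (l, m) : Sym K ⊗[K] Sym K →ₗ[K] K) =
      tensorForm (hall K (schur K l)) (hall K (schur K m)) := by
    intro l m
    refine TensorProduct.ext' fun x y => ?_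
    rw [tensorForm_tmul, hall_schur_left, hall_schur_left, Module.Basis.coord_apply,
      Module.Basis.tensorProduct_repr_tmul_apply]
    simp [mul_comm]
  refine b.repr.injective (Finsupp.ext fun p => ?_)
  have := h p.1 p.2
  rw [← hb] at this
  exact this

theorem hall_mul (f g h : Sym K) :
    hall K f (g * h) = tensorForm (hall K g) (hall K h) (comul K f) := by
  rw [hall_eq_pairing, pairing_mul]

/-- The Schur functions outside `S` do not occur in the coproduct of `f`. -/
def SupportedOn (S : Finset YoungDiagram) (f : Sym K) : Prop :=
  ∀ l ∉ S, ∀ g, hall K f (schur K l * g) = 0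

theorem SupportedOn.perp {S : Finset YoungDiagram} {f : Sym K} (hf : SupportedOn S f)
    (a : Sym K) : SupportedOn S (perp K a f) := fun l hl g => by
  rw [hall_perp, mul_left_comm, hf l hl]

theorem supportedOn_of_homogeneous {S : Finset YoungDiagram} {f : Sym K} {d : ℕ}
    (hf : IsWeightedHomogeneous degWeight f d) (hS : ∀ l : YoungDiagram, l.card ≤ d → l ∈ S) :
    SupportedOn S f := by
  intro l hl g
  have h : hall K f ∘ₗ LinearMap.mulLeft K (schur K l) = 0 := by
    refine (schurBasis K).ext fun m => ?_
    rw [schurBasis_apply, LinearMap.comp_apply, LinearMap.mulLeft_apply, LinearMap.zero_apply]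
    refine hall_eq_zero hf ((isWeightedHomogeneous_schur K l).mul
      (isWeightedHomogeneous_schur K m)) fun hd => hl (hS l ?_)
    omega
  exact LinearMap.congr_fun h g

/-- The coordinate of the coproduct at $s_l\otimes s_m$ is $\langle f,s_ls_m\rangle=\langle
s_l^\perp f,s_m\rangle$. The set $S$ only keeps the sum finite. -/
theorem comul_eq_sum {S : Finset YoungDiagram} {f : Sym K} (hf : SupportedOn S f) :
    comul K f = ∑ l ∈ S, schur K l ⊗ₜ perp K (schur K l) f := by
  classical
  refine tensor_ext fun l m => ?_
  rw [← hall_mul, map_sum]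
  simp only [tensorForm_tmul, hall_schur, ite_mul, one_mul, zero_mul, Finset.sum_ite_eq]
  split_ifs with h
  · rw [← hall_perp, hall_comm]
  · exact hf l h _

theorem conv_eq_sum {S : Finset YoungDiagram} {f : Sym K} (hf : SupportedOn S f)
    (φ ψ : Sym K →ₐ[K] A) :
    conv φ ψ f = ∑ l ∈ S, φ (schur K l) * ψ (perp K (schur K l) f) := by
  rw [conv_eq_lift, comul_eq_sum hf, map_sum]
  simp

/-- The evaluation at a sum of `n` alphabets. -/
theorem aeval_sum_eq {S : Finset YoungDiagram} {n : ℕ} (φ : Fin n → Sym K →ₐ[K] A) {f : Sym K}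
    (hf : SupportedOn S f) : aeval (fun k => ∑ i, φ i (X k)) f =
      ∑ v ∈ Fintype.piFinset fun _ : Fin n => S,
        hall K f (∏ i, schur K (v i)) • ∏ i, φ i (schur K (v i)) := by
  induction n generalizing f with
  | zero =>
    simp only [Finset.univ_eq_empty, Finset.sum_empty, Finset.prod_empty]
    -- The empty alphabet sends every $p_k$ to 0, which leaves the constant term.
    rw [Fintype.piFinset_of_isEmpty, Fintype.sum_unique, hall_comm, hall_eq_pairing, pairing_one,
      Algebra.smul_def, mul_one]
    simp
  | succ n ih =>
    have h : aeval (fun k => ∑ i, φ i (X k)) =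
        conv (φ 0) (aeval fun k => ∑ i : Fin n, φ i.succ (X k)) := by
      ext k; simp [conv, Fin.sum_univ_succ]
    rw [h, conv_eq_sum hf]
    -- The induction runs over all $f$ because the remaining alphabets are evaluated at $s_l^\perp
    -- f$; adjointness later returns $s_l$ to the product inside the Hall form.
    simp only [fun l => ih (fun i => φ i.succ) (hf.perp (schur K l)), Finset.mul_sum]
    rw [← Finset.sum_product']
    refine Finset.sum_nbij' (fun p => Fin.cons p.1 p.2) (fun v => (v 0, Fin.tail v)) ?_ ?_ ?_ ?_ ?_
    · rintro ⟨l, v⟩ hp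
      rw [Finset.mem_product, Fintype.mem_piFinset] at hp
      rw [Fintype.mem_piFinset]
      exact Fin.cases hp.1 hp.2
    · intro v hv
      rw [Fintype.mem_piFinset] at hv
      rw [Finset.mem_product, Fintype.mem_piFinset]
      exact ⟨hv 0, fun i => hv i.succ⟩
    · rintro ⟨l, v⟩ _
      simp
    · intro v _
      simp
    · rintro ⟨l, v⟩ _
      simp only [Fin.prod_univ_succ, Fin.cons_zero, Fin.cons_succ]
      rw [hall_perp, mul_smul_comm]

end Expansion

/-! ### Adjoints of multiplication by elementary symmetric functions -/

section Column

variable (K : Type*) [CommRing K] [Algebra ℚ K]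

theorem rowLen_column (r i : ℕ) : (column r).rowLen i = if i < r then 1 else 0 := by
  have h : ∀ j, j < (column r).rowLen i ↔ j < if i < r then 1 else 0 := by
    intro j
    rw [← YoungDiagram.mem_iff_lt_rowLen, ← YoungDiagram.mem_cells]
    simp only [column, Finset.mem_product, Finset.mem_range, Finset.mem_singleton]
    split_ifs <;> omega
  exact le_antisymm (not_lt.1 fun hlt => lt_irrefl _ ((h _).1 hlt))
    (not_lt.1 fun hlt => lt_irrefl _ ((h _).2 hlt))

theorem card_column (r : ℕ) : (column r).card = r := by
  simp [YoungDiagram.card, column]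

theorem colLen_column (r : ℕ) : (column r).colLen 0 = r := by
  have h : ∀ i, i < (column r).colLen 0 ↔ i < r := by
    intro i
    rw [← YoungDiagram.mem_iff_lt_colLen, ← YoungDiagram.mem_cells]
    simp [column]
  exact le_antisymm (not_lt.1 fun hlt => lt_irrefl _ ((h _).1 hlt))
    (not_lt.1 fun hlt => lt_irrefl _ ((h _).2 hlt))

theorem column_zero : column 0 = ⊥ := card_eq_zero_iff.1 (card_column 0)

theorem dualVar_completeInt {A : Type*} [CommRing A] [Algebra K A] (t : A) (k : ℤ) :
    dualVar K t (completeInt K k) = if k = 0 then 1 else if k = 1 then t else 0 := by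
  rcases lt_or_ge k 0 with hk | hk
  · rw [completeInt_neg K hk, map_zero, if_neg (by omega), if_neg (by omega)]
  · obtain ⟨m, rfl⟩ := Int.eq_ofNat_of_zero_le hk
    rw [completeInt_natCast, dualVar_complete]
    norm_cast

/-- At one negated variable only $h_0=1$ and $h_1=t$ survive. For a column the Jacobi–Trudi matrix
is lower triangular with diagonal $t$; any other shape has first row at least 2, so the first matrix
row is zero. -/
theorem dualVar_schur {A : Type*} [CommRing A] [Algebra K A] [DecidableEq YoungDiagram] (t : A)
    (l : YoungDiagram) :
    dualVar K t (schur K l) = if l = column l.card then t ^ l.card else 0 := by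
  rw [map_schur]
  split_ifs with h
  · obtain ⟨r, rfl⟩ : ∃ r, l = column r := ⟨_, h⟩
    rw [jtDet, Matrix.det_of_isLowerTriangular]
    · have h1 : ∀ i : Fin ((column r).colLen 0), (Matrix.of fun i j : Fin ((column r).colLen 0) =>
          dualVar K t (completeInt K (((column r).rowLen i : ℤ) - (i : ℤ) + (j : ℤ)))) i i = t := by
        intro i
        have hi : (i : ℕ) < r := i.2.trans_eq (colLen_column r)
        simp [dualVar_completeInt, rowLen_column, hi]
      rw [Finset.prod_congr rfl fun i _ => h1 i]
      simp [colLen_column, card_column]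
    · intro i j hij
      have hij' : (i : ℕ) < j := hij
      have hi : (i : ℕ) < r := i.2.trans_eq (colLen_column r)
      rw [Matrix.of_apply, dualVar_completeInt, rowLen_column, if_pos hi,
        if_neg (by push_cast; omega), if_neg (by push_cast; omega)]
  · have h2 : 2 ≤ l.rowLen 0 := by
      by_contra h2
      refine h ?_
      have h3 : ∀ i, l.rowLen i = if i < l.colLen 0 then 1 else 0 := by
        intro i
        have := l.rowLen_anti 0 i (Nat.zero_le i)
        split_ifs with hi
        · have : 0 < l.rowLen i := by
            rw [← YoungDiagram.mem_iff_lt_rowLen, YoungDiagram.mem_iff_lt_colLen]; exact hi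
          omega
        · exact rowLen_eq_zero (not_lt.1 hi)
      have h4 : l = column (l.colLen 0) := ext_rowLen fun i => by rw [h3, rowLen_column]
      have h5 : l.card = l.colLen 0 := by
        have := congrArg YoungDiagram.card h4
        rwa [card_column] at this
      rw [h5]; exact h4
    have hN : 0 < l.colLen 0 := by
      rw [← YoungDiagram.mem_iff_lt_colLen, YoungDiagram.mem_iff_lt_rowLen]; omega
    rw [jtDet, Matrix.det_eq_zero_of_row_eq_zero ⟨0, hN⟩]
    intro j
    rw [Matrix.of_apply, dualVar_completeInt, if_neg (by push_cast; omega),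
      if_neg (by push_cast; omega)]

/-- Orthonormality allows a comparison on the Schur basis, so no coproduct formula for $s_{1^r}$ is
needed. -/
theorem pairing_column (r : ℕ) (f : Sym K) : pairing K (schur K (column r)) f =
    (dualVar K (Polynomial.X : K[X]) f).coeff r := by
  classical
  have h : pairing K (schur K (column r)) =
      (Polynomial.lcoeff K r) ∘ₗ (dualVar K (Polynomial.X : K[X])).toLinearMap := by
    refine (schurBasis K).ext fun l => ?_
    rw [schurBasis_apply, pairing_schur_schur, LinearMap.comp_apply, AlgHom.toLinearMap_apply,
      Polynomial.lcoeff_apply, dualVar_schur]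
    split_ifs with h1 h2 h2
    · rw [← h1, card_column, Polynomial.coeff_X_pow_self]
    · exact absurd (by rw [← h1, card_column]) h2
    · rw [Polynomial.coeff_X_pow, if_neg]
      rintro rfl
      exact h1 h2.symm
    · simp
  exact LinearMap.congr_fun h f

/-- The coefficients of `addDualVar` are the operators `e_r^⊥`. -/
theorem coeff_addDualVar (r : ℕ) (f : Sym K) :
    (addDualVar K f).coeff r = perp K (schur K (column r)) f := by
  refine eq_of_hall fun l => ?_
  rw [hall_perp, hall_eq_pairing,
    ← pairing_coeff_conv K (dualVar K Polynomial.X) _ r (pairing_column K r)]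
  have : dualVar K (Polynomial.X : (Sym K)[X]) =
      (Polynomial.mapAlgHom (Algebra.ofId K (Sym K))).comp (dualVar K (Polynomial.X : K[X])) := by
    ext k; simp [dualVar]
  rw [addDualVar, this]

end Column

/-! ### Vertical strips -/

section VerticalStrips

/-- Each row is a sum of two rows, so multilinearity suffices and no row operations are needed. -/
theorem jtDet_branch_two {A : Type*} [CommRing A] {h H : ℤ → A} {t : A}
    (hrec : ∀ k, H k = h k + t * h (k - 1)) (N : ℕ) (a : ℕ → ℕ) :
    jtDet H N a = ∑ m ∈ Fintype.piFinset fun _ : Fin N => Finset.range 2,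
      t ^ (∑ i, m i) *
        Matrix.det (Matrix.of fun i j : Fin N => h ((a i : ℤ) - m i - (i : ℤ) + (j : ℤ))) := by
  have hrow : (Matrix.of fun i j : Fin N => H ((a i : ℤ) - (i : ℤ) + (j : ℤ))) =
      Matrix.of fun i : Fin N => ∑ m ∈ Finset.range 2,
        (fun j : Fin N => t ^ m * h ((a i : ℤ) - m - (i : ℤ) + (j : ℤ))) := by
    ext i j
    simp only [Matrix.of_apply, Finset.sum_range_succ, Finset.range_zero, Finset.sum_empty,
      zero_add, Pi.add_apply, hrec]
    rw [pow_zero, pow_one, one_mul, Nat.cast_zero, sub_zero, Nat.cast_one,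
      show (a i : ℤ) - i + j - 1 = (a i : ℤ) - 1 - i + j by ring]
  rw [jtDet, hrow]
  have hml := (Matrix.detRowAlternating (n := Fin N) (R := A)).toMultilinearMap.map_sum_finset
    (fun (i : Fin N) (m : ℕ) =>
      (fun j : Fin N => t ^ m * h ((a i : ℤ) - m - (i : ℤ) + (j : ℤ))))
    (fun _ : Fin N => Finset.range 2)
  refine hml.trans (Finset.sum_congr rfl fun m _ => ?_)
  rw [← Finset.prod_pow_eq_pow_sum, ← Matrix.det_mul_column]
  rfl

theorem finite_verticalStrips (l : YoungDiagram) : {k : YoungDiagram |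
    ∀ i, l.rowLen i ≤ k.rowLen i + 1 ∧ k.rowLen i ≤ l.rowLen i}.Finite := by
  have hinj : Function.Injective YoungDiagram.cells := fun l l' h => YoungDiagram.ext h
  refine Set.Finite.of_finite_image (f := YoungDiagram.cells) ?_ hinj.injOn
  refine (Finset.finite_toSet l.cells.powerset).subset ?_
  rintro _ ⟨k, hk, rfl⟩
  have h1 : k ≤ l := le_of_rowLen fun i => (hk i).2
  exact Finset.mem_coe.2 (Finset.mem_powerset.2 (YoungDiagram.cells_subset_iff.2 h1))

/-- The partitions `k` such that `l / k` is a vertical strip. -/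
noncomputable def verticalStrips (l : YoungDiagram) : Finset YoungDiagram :=
  (finite_verticalStrips l).toFinset

theorem mem_verticalStrips {l k : YoungDiagram} : k ∈ verticalStrips l ↔
    ∀ i, l.rowLen i ≤ k.rowLen i + 1 ∧ k.rowLen i ≤ l.rowLen i := by
  rw [verticalStrips, Set.Finite.mem_toFinset, Set.mem_ofPred_eq]

theorem card_verticalStrip {l k : YoungDiagram} (h : k ∈ verticalStrips l) :
    l.card - k.card = ∑ i : Fin (l.colLen 0), (l.rowLen i - k.rowLen i) := by
  rw [mem_verticalStrips] at h
  rw [card_eq_sum, card_eq_sum_of_le (colLen_le_of_rowLen fun i => (h i).2),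
    ← Finset.sum_tsub_distrib (f := fun i : Fin (l.colLen 0) => l.rowLen i)
      (g := fun i => k.rowLen i) _ fun i _ => (h i).2]

/-- A choice of 0 or 1 cell removed per row either leaves a partition, giving a vertical strip, or
breaks monotonicity, and then two rows of the determinant coincide. -/
theorem jtDet_verticalStrips {A : Type*} [CommRing A] {h H : ℤ → A} {t : A} (h0 : h 0 = 1)
    (hneg : ∀ k < 0, h k = 0) (hrec : ∀ k, H k = h k + t * h (k - 1)) (l : YoungDiagram) :
    jtDet H (l.colLen 0) l.rowLen =
      ∑ k ∈ verticalStrips l, t ^ (l.card - k.card) * jtDet h (k.colLen 0) k.rowLen := by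
  have hanti : ∀ i, l.rowLen (i + 1) ≤ l.rowLen i := fun i => l.rowLen_anti _ _ (Nat.le_succ i)
  have hpos : ∀ i : Fin (l.colLen 0), 0 < l.rowLen i := fun i => by
    rw [← YoungDiagram.mem_iff_lt_rowLen, YoungDiagram.mem_iff_lt_colLen]; exact i.2
  rw [jtDet_branch_two hrec]
  symm
  refine Finset.sum_of_injOn (fun k => fun i : Fin (l.colLen 0) => l.rowLen i - k.rowLen i)
    ?_ ?_ ?_ ?_
  · intro k hk k' hk' heq
    rw [Finset.mem_coe, mem_verticalStrips] at hk hk'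
    refine ext_rowLen fun i => ?_
    have h1 := hk i
    have h2 := hk' i
    by_cases hi : i < l.colLen 0
    · have := congrFun heq ⟨i, hi⟩
      simp only at this
      omega
    · have := rowLen_eq_zero (not_lt.1 hi)
      omega
  · intro k hk
    rw [Finset.mem_coe, mem_verticalStrips] at hk
    rw [Finset.mem_coe, Fintype.mem_piFinset]
    intro i
    have := hk i
    rw [Finset.mem_range]
    change l.rowLen i - k.rowLen i < 2
    omega
  · intro m hm hnot
    rw [Fintype.mem_piFinset] at hm
    have hm : ∀ i, m i < 2 := fun i => Finset.mem_range.1 (hm i)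
    let b : ℕ → ℕ := fun i => if hi : i < l.colLen 0 then l.rowLen i - m ⟨i, hi⟩ else 0
    have hb : ∀ i (hi : i < l.colLen 0), b i = l.rowLen i - m ⟨i, hi⟩ := fun i hi => dif_pos hi
    have hb0 : ∀ i, ¬ i < l.colLen 0 → b i = 0 := fun i hi => dif_neg hi
    by_cases hanti' : ∀ i, b (i + 1) ≤ b i
    · refine absurd ?_ hnot
      refine ⟨ofRows (l.colLen 0) b (antitone_nat_of_succ_le hanti'), ?_, ?_⟩
      · rw [Finset.mem_coe, mem_verticalStrips]
        intro i
        rw [rowLen_ofRows]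
        split_ifs with hi
        · have := hm ⟨i, hi⟩
          rw [hb i hi]; omega
        · have := rowLen_eq_zero (not_lt.1 hi)
          omega
      · funext i
        have h1 := hm i
        have h2 := hpos i
        simp only [rowLen_ofRows, if_pos i.2, hb i i.2, Fin.eta]
        omega
    · push Not at hanti'
      obtain ⟨i, hi⟩ := hanti'
      have hi1 : i + 1 < l.colLen 0 := by
        by_contra hcon
        rw [hb0 _ hcon] at hi
        exact absurd hi (Nat.not_lt_zero _)
      have hi0 : i < l.colLen 0 := by omega
      rw [hb _ hi1, hb _ hi0] at hi
      have h1 := hm ⟨i, hi0⟩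
      have h2 := hanti i
      -- An ascent forces equal lengths of rows $i$ and $i+1$ in $l$, with a cell removed from row
      -- $i$ only. The shift by $-1$ then equals the row shift in Jacobi–Trudi.
      rw [Matrix.det_zero_of_row_eq (i := ⟨i, hi0⟩) (j := ⟨i + 1, hi1⟩)
        (by simp), mul_zero]
      funext j
      simp only [Matrix.of_apply]
      congr 1
      push_cast
      omega
  · intro k hk
    rw [card_verticalStrip hk]
    rw [mem_verticalStrips] at hk
    congr 1
    rw [← jtDet_padding h h0 hneg k.rowLen _ _ (colLen_le_of_rowLen fun i => (hk i).2)
      fun i hi => rowLen_eq_zero hi, jtDet]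
    congr 1
    ext i j
    rw [Matrix.of_apply, Matrix.of_apply, Nat.cast_sub (hk i).2]
    congr 1; ring

theorem transpose_mem_strips {l k : YoungDiagram} :
    k.transpose ∈ strips l.transpose ↔ k ∈ verticalStrips l := by
  rw [mem_strips, mem_verticalStrips]
  simp only [YoungDiagram.rowLen_transpose]
  constructor
  · intro h i
    have hsub : ∀ j, j < k.rowLen i → j < l.rowLen i := by
      intro j hj
      rw [← YoungDiagram.mem_iff_lt_rowLen, YoungDiagram.mem_iff_lt_colLen] at hj ⊢
      exact hj.trans_le (h j).2
    have hsup : ∀ j, j + 1 < l.rowLen i → j < k.rowLen i := by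
      intro j hj
      rw [← YoungDiagram.mem_iff_lt_rowLen, YoungDiagram.mem_iff_lt_colLen] at hj ⊢
      exact hj.trans_le (h j).1
    constructor
    · by_contra hcon
      have := hsup (k.rowLen i) (by omega)
      omega
    · by_contra hcon
      have := hsub (l.rowLen i) (by omega)
      omega
  · intro h j
    have hsub : ∀ i, i < k.colLen j → i < l.colLen j := by
      intro i hi
      rw [← YoungDiagram.mem_iff_lt_colLen, YoungDiagram.mem_iff_lt_rowLen] at hi ⊢
      exact hi.trans_le (h i).2
    have hsup : ∀ i, i < l.colLen (j + 1) → i < k.colLen j := by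
      intro i hi
      rw [← YoungDiagram.mem_iff_lt_colLen, YoungDiagram.mem_iff_lt_rowLen] at hi ⊢
      have := (h i).1
      omega
    constructor
    · by_contra hcon
      have := hsup (k.colLen j) (by omega)
      omega
    · by_contra hcon
      have := hsub (l.colLen j) (by omega)
      omega

theorem card_transpose (l : YoungDiagram) : l.transpose.card = l.card := by
  simp [YoungDiagram.card, YoungDiagram.transpose]

end VerticalStrips

/-! ### The involution on Schur functions -/

section Omega

variable (K : Type*) [CommRing K] [Algebra ℚ K]

theorem addDualVar_schur (l : YoungDiagram) : addDualVar K (schur K l) =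
    ∑ k ∈ verticalStrips l, Polynomial.X ^ (l.card - k.card) * Polynomial.C (schur K k) := by
  rw [map_schur, jtDet_verticalStrips (h := fun k => Polynomial.CAlgHom (R := K) (completeInt K k))
    (t := Polynomial.X)]
  · refine Finset.sum_congr rfl fun k _ => ?_
    rw [← map_schur]; rfl
  · simp [completeInt, complete_zero]
  · intro k hk; rw [completeInt_neg K hk, map_zero]
  · exact conv_dualVar_completeInt _ _

/-- A vertical strip has at most one cell in each row. This is where $\ell(\mu)$ enters: $e_i^\perp
s_\mu=0$ for $i>\ell(\mu)$. -/
theorem natDegree_addDualVar_schur (l : YoungDiagram) :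
    (addDualVar K (schur K l)).natDegree ≤ l.colLen 0 := by
  rw [addDualVar_schur]
  refine Polynomial.natDegree_sum_le_of_forall_le _ _ fun k hk => ?_
  refine (Polynomial.natDegree_mul_C_le _ _).trans ((Polynomial.natDegree_X_pow_le _).trans ?_)
  rw [card_verticalStrip hk]
  refine (Finset.sum_le_card_nsmul _ _ 1 fun i _ => ?_).trans (by simp)
  have := mem_verticalStrips.1 hk i
  omega

theorem omega_X (k : ℕ+) : omega K (X k) = (-1) ^ ((k : ℕ) + 1) * X k := by simp [omega]

/-- Coefficientwise this says $h_n^\perp\omega=\omega e_n^\perp$; on $p_k$ both sides are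
$(-1)^{k+1}(t^k+p_k)$. -/
theorem addVar_omega (f : Sym K) :
    addVar K (omega K f) = Polynomial.mapAlgHom (omega K) (addDualVar K f) := by
  have h : (addVar K).comp (omega K) =
      (Polynomial.mapAlgHom (omega K)).comp (addDualVar K) := by
    ext k : 1
    simp only [AlgHom.comp_apply, omega_X, map_mul, map_pow, map_neg, map_one, addVar, addDualVar,
      conv_X, map_add, oneVar, dualVar, aeval_X, Polynomial.coe_mapAlgHom, Polynomial.CAlgHom_apply]
    simp [omega_X, mul_add]
  exact AlgHom.congr_fun h f

/-- A symmetric function annihilated by all `h_n^⊥` with `n > 0` and by the constants is zero. -/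
theorem eq_zero_of_addVar {f : Sym K} (h1 : hall K f 1 = 0)
    (h : ∀ n, (addVar K f).coeff (n + 1) = 0) : f = 0 := by
  have hn : ∀ n : ℕ, ∀ g, hall K f (complete K (n + 1) * g) = 0 := by
    intro n g
    rw [hall_eq_pairing, ← pairing_addVar, h, map_zero, LinearMap.zero_apply]
  refine eq_of_hall fun l => ?_
  rw [map_zero, LinearMap.zero_apply]
  by_cases hl : l.card = 0
  · rw [card_eq_zero_iff.1 hl, schur_bot, h1]
  · have hpos := rowLen_zero_pos hl
    obtain ⟨N, hN⟩ : ∃ N, l.colLen 0 = N + 1 := Nat.exists_eq_add_one.2 (by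
      rw [← YoungDiagram.mem_iff_lt_colLen, YoungDiagram.mem_iff_lt_rowLen]; exact hpos)
    -- The entries of the first Jacobi–Trudi row are $h_k$ with $k\ge l_0\ge1$, so each term of the
    -- expansion is a multiple of some $h_{n+1}$.
    rw [← AlgHom.id_apply (R := K) (schur K l), map_schur, hN, jtDet, Matrix.det_succ_row_zero,
      map_sum]
    refine Finset.sum_eq_zero fun j _ => ?_
    have hj : ((l.rowLen ((0 : Fin (N + 1)) : ℕ) : ℤ) - ((0 : Fin (N + 1)) : ℕ) + (j : ℕ)) =
        ((l.rowLen 0 - 1 + j + 1 : ℕ) : ℤ) := by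
      push_cast [Nat.cast_sub (show 1 ≤ l.rowLen 0 from hpos)]
      simp
      ring
    rw [Matrix.of_apply, hj, AlgHom.id_apply, completeInt_natCast, mul_right_comm, mul_comm, hn]

/-- For $n>0$, $h_n^\perp\omega s_l=\omega e_n^\perp s_l$ is a sum of $\omega s_k$ over vertical
strips $l/k$. By induction and transposition this is the sum over horizontal strips giving
$h_n^\perp s_{l'}$. The constant terms agree as well. -/
theorem omega_schur (l : YoungDiagram) : omega K (schur K l) = schur K l.transpose := by
  classical
  induction hc : l.card using Nat.strong_induction_on generalizing l with
  | _ c ih =>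
    rw [← sub_eq_zero]
    by_cases hl : l = ⊥
    · have ht : (⊥ : YoungDiagram).transpose = ⊥ := by
        rw [← card_eq_zero_iff, card_transpose, card_eq_zero_iff]
      rw [hl, ht, schur_bot, map_one, sub_self]
    · refine eq_zero_of_addVar K ?_ fun n => ?_
      · have ht : l.transpose ≠ ⊥ := by
          rwa [Ne, ← card_eq_zero_iff, card_transpose, card_eq_zero_iff]
        have hcc : (constantCoeff : Sym K →+* K).comp (omega K).toRingHom = constantCoeff := by
          ext <;> simp [omega]
        have h1 : hall K (omega K (schur K l)) 1 = hall K (schur K l) 1 := by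
          rw [hall_comm, hall_comm (schur K l), hall_eq_pairing, pairing_one, pairing_one]
          exact RingHom.congr_fun hcc _
        rw [map_sub, LinearMap.sub_apply, h1, hall_eq_pairing, pairing_schur_one, if_neg hl,
          pairing_schur_one, if_neg ht, sub_zero]
      · have h1 : addVar K (schur K l.transpose) = ∑ k ∈ verticalStrips l,
            Polynomial.X ^ (l.card - k.card) * Polynomial.C (schur K k.transpose) := by
          rw [addVar_schur]
          refine Finset.sum_nbij' YoungDiagram.transpose YoungDiagram.transpose ?_ ?_ ?_ ?_ ?_
          · intro k hk
            rw [← transpose_mem_strips, YoungDiagram.transpose_transpose]; exact hk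
          · intro k hk
            exact transpose_mem_strips.2 hk
          · intro k _; exact YoungDiagram.transpose_transpose k
          · intro k _; exact YoungDiagram.transpose_transpose k
          · intro k _
            rw [card_transpose, card_transpose, YoungDiagram.transpose_transpose]
        rw [map_sub, addVar_omega, addDualVar_schur, h1, map_sum, ← Finset.sum_sub_distrib,
          Polynomial.finsetSum_coeff]
        refine Finset.sum_eq_zero fun k _ => ?_
        rw [map_mul, map_pow, Polynomial.coe_mapAlgHom, Polynomial.map_X, Polynomial.map_C,
          ← mul_sub, ← map_sub, Polynomial.coeff_mul_C, Polynomial.coeff_X_pow]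
        split_ifs with hk
        -- The strip has $n+1>0$ cells, so $k$ is smaller than $l$.
        · have := ih k.card (by omega) k rfl
          simp only [RingHom.coe_coe, this, sub_self, mul_zero]
        · rw [zero_mul]

theorem iterate_omega_schur (i : ℕ) (v : YoungDiagram) : (omega K)^[i] (schur K v) =
    if Even i then schur K v else schur K v.transpose := by
  induction i with
  | zero => simp
  | succ i ih =>
    rw [Function.iterate_succ_apply', ih]
    by_cases h : Even i
    · rw [if_pos h, if_neg (by rwa [Nat.even_add_one, not_not]), omega_schur]
    · rw [if_neg h, if_pos (by rwa [Nat.even_add_one]), omega_schur,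
        YoungDiagram.transpose_transpose]

end Omega

/-! ### Plethysm and the operators `e_r^⊥` -/

section Plethysm

variable {K : Type*} [CommRing K] {A : Type*} [CommRing A] [Algebra K A]

theorem aeval_iterate_omega (i : ℕ) (a : ℕ+ → A) (f : Sym K) :
    aeval a ((omega K)^[i] f) = aeval (fun k : ℕ+ => ((-1) ^ ((k : ℕ) + 1)) ^ i * a k) f := by
  induction i generalizing f with
  | zero => simp
  | succ i ih =>
    rw [Function.iterate_succ_apply, ih]
    have h : (aeval fun k : ℕ+ => ((-1 : A) ^ ((k : ℕ) + 1)) ^ i * a k).comp (omega K) =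
        aeval (fun k : ℕ+ => ((-1 : A) ^ ((k : ℕ) + 1)) ^ (i + 1) * a k) := by
      ext k
      simp only [AlgHom.comp_apply, omega, aeval_X, map_mul, map_pow, map_neg, map_one]
      ring
    exact AlgHom.congr_fun h f

theorem aeval_pow_mul {f : Sym K} {d : ℕ} (hf : IsWeightedHomogeneous degWeight f d) (t : A)
    (a : ℕ+ → A) : aeval (fun k : ℕ+ => t ^ (k : ℕ) * a k) f = t ^ d * aeval a f := by
  rw [f.as_sum, map_sum, map_sum, Finset.mul_sum]
  refine Finset.sum_congr rfl fun m hm => ?_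
  have h := hf (mem_support_iff.1 hm)
  rw [Finsupp.weight_apply] at h
  have hp : m.prod (fun k e => (t ^ (k : ℕ) * a k) ^ e) =
      t ^ d * m.prod fun k e => a k ^ e := by
    rw [← h, Finsupp.sum, ← Finset.prod_pow_eq_pow_sum, Finsupp.prod, Finsupp.prod,
      ← Finset.prod_mul_distrib]
    refine Finset.prod_congr rfl fun k _ => ?_
    rw [mul_pow, ← pow_mul, smul_eq_mul, mul_comm (m k), degWeight]
  rw [aeval_monomial, aeval_monomial, hp, mul_left_comm]

/-- Used with $I=(t^{r+1})$ to discard the alphabets of index larger than $r$. -/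
theorem aeval_sub_mem (I : Ideal A) {a b : ℕ+ → A} (h : ∀ k, a k - b k ∈ I) (f : Sym K) :
    aeval a f - aeval b f ∈ I := by
  have : (Ideal.Quotient.mkₐ K I).comp (aeval a : Sym K →ₐ[K] A) =
      (Ideal.Quotient.mkₐ K I).comp (aeval b) := by
    ext k
    simpa using Ideal.Quotient.eq.2 (h k)
  exact Ideal.Quotient.eq.1 (AlgHom.congr_fun this f)

variable [Algebra ℚ K]

variable (K) in
/-- The symmetric function `p_r[g]` over `K`. -/
noncomputable def powerPlethMap (r : ℕ+) : Sym ℚ →+* Sym K :=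
  (map (algebraMap ℚ K)).comp (powerPleth r : Sym ℚ →+* Sym ℚ)

variable (K) in
/-- The substitution `t ↦ (-1)^{r+1} t^r`, together with `g ↦ p_r[g]` on the coefficients. -/
noncomputable def powerPlethPoly (r : ℕ+) : (Sym ℚ)[X] →+* (Sym K)[X] :=
  Polynomial.eval₂RingHom (Polynomial.C.comp (powerPlethMap K r))
    ((-1) ^ ((r : ℕ) + 1) * Polynomial.X ^ (r : ℕ))

theorem powerPlethPoly_X (r : ℕ+) : powerPlethPoly K r Polynomial.X =
    (-1) ^ ((r : ℕ) + 1) * Polynomial.X ^ (r : ℕ) := by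
  rw [powerPlethPoly, Polynomial.coe_eval₂RingHom, Polynomial.eval₂_X]

theorem powerPlethPoly_C (r : ℕ+) (g : Sym ℚ) : powerPlethPoly K r (Polynomial.C g) =
    Polynomial.C (powerPlethMap K r g) := by
  rw [powerPlethPoly, Polynomial.coe_eval₂RingHom, Polynomial.eval₂_C, RingHom.comp_apply]

variable (K) in
theorem addDualVar_X (k : ℕ+) : addDualVar K (X k) =
    (-1) ^ ((k : ℕ) + 1) * Polynomial.X ^ (k : ℕ) + Polynomial.C (X k) := by
  rw [addDualVar, conv_X, dualVar, aeval_X, Polynomial.CAlgHom_apply]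

/-- The exponents on the two sides differ by $2k$. This sign is why the substitution in
`powerPlethPoly` must be $t\mapsto(-1)^{r+1}t^r$. -/
theorem neg_one_pow_mul_succ {R : Type*} [CommRing R] (r k : ℕ) :
    (-1 : R) ^ (r * k + 1) = (-1) ^ (k + 1) * ((-1) ^ (r + 1)) ^ k := by
  have h : k + 1 + (r + 1) * k = (r * k + 1) + (k + k) := by ring
  rw [← pow_mul, ← pow_add, h, pow_add _ _ (k + k), (Even.add_self k).neg_one_pow, mul_one]

/-- Both sides are ring homomorphisms in $g$; they agree on rational constants, and on $p_k$ both
give $(-1)^{rk+1}t^{rk}+p_{rk}$. -/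
theorem addDualVar_powerPleth (r : ℕ+) (g : Sym ℚ) :
    addDualVar K (powerPlethMap K r g) = powerPlethPoly K r (addDualVar ℚ g) := by
  let φ : Sym ℚ →+* (Sym K)[X] := (addDualVar K : Sym K →+* (Sym K)[X]).comp (powerPlethMap K r)
  let ψ : Sym ℚ →+* (Sym K)[X] := (powerPlethPoly K r).comp (addDualVar ℚ : Sym ℚ →+* (Sym ℚ)[X])
  have h : φ = ψ := by
    refine MvPolynomial.ringHom_ext
      (fun q => RingHom.congr_fun (RingHom.ext_rat (φ.comp C) (ψ.comp C)) q) fun k => ?_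
    have h1 : powerPlethMap K r (X k) = X (r * k) := by simp [powerPlethMap, powerPleth]
    change addDualVar K (powerPlethMap K r (X k)) = powerPlethPoly K r (addDualVar ℚ (X k))
    rw [h1, addDualVar_X, addDualVar_X, map_add, powerPlethPoly_C, h1, map_mul, map_pow, map_pow,
      map_neg, map_one, powerPlethPoly_X, PNat.mul_coe, neg_one_pow_mul_succ, mul_pow,
      ← pow_mul Polynomial.X, mul_assoc]
  exact RingHom.congr_fun h g

theorem addDualVar_pleth (f : Sym K) {g : Sym ℚ} {N : ℕ}
    (hN : (addDualVar ℚ g).natDegree ≤ N) : addDualVar K (pleth K f g) =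
    aeval (fun k : ℕ+ => ∑ i ∈ Finset.range (N + 1),
      (Polynomial.X ^ i) ^ (k : ℕ) * (((-1) ^ ((k : ℕ) + 1)) ^ i *
        Polynomial.C (powerPlethMap K k (perp ℚ (schur ℚ (column i)) g)))) f := by
  have h : (addDualVar K).comp (aeval fun r => powerPlethMap K r g) =
      aeval (fun k : ℕ+ => ∑ i ∈ Finset.range (N + 1),
        (Polynomial.X ^ i) ^ (k : ℕ) * (((-1) ^ ((k : ℕ) + 1)) ^ i *
          Polynomial.C (powerPlethMap K k (perp ℚ (schur ℚ (column i)) g)))) := by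
    ext k : 1
    rw [AlgHom.comp_apply, aeval_X, aeval_X, addDualVar_powerPleth,
      powerPlethPoly, Polynomial.coe_eval₂RingHom,
      Polynomial.eval₂_eq_sum_range' _ (Nat.lt_succ_of_le hN)]
    refine Finset.sum_congr rfl fun i _ => ?_
    rw [coeff_addDualVar, RingHom.comp_apply]
    ring
  exact AlgHom.congr_fun h f

/-- In `e_r^⊥(f[g])` only the terms `e_i^⊥ g` with `i ≤ r` matter. -/
theorem perp_column_pleth (f : Sym K) {g : Sym ℚ} {N : ℕ}
    (hN : (addDualVar ℚ g).natDegree ≤ N) (r : ℕ) :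
    perp K (schur K (column r)) (pleth K f g) =
    (aeval (fun k : ℕ+ => ∑ i : Fin (min r N + 1),
      (Polynomial.X ^ (i : ℕ)) ^ (k : ℕ) * (((-1) ^ ((k : ℕ) + 1)) ^ (i : ℕ) *
        Polynomial.C (powerPlethMap K k (perp ℚ (schur ℚ (column i)) g)))) f :
          (Sym K)[X]).coeff r := by
  rw [← coeff_addDualVar, addDualVar_pleth f hN, ← sub_eq_zero, ← Polynomial.coeff_sub]
  -- The coefficient of $t^r$ is determined modulo $t^{r+1}$. A dropped index satisfies
  -- $\min(r,N)<i\le N$, hence $i>r$, and its term carries $t^{ik}$ with $k\ge1$.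
  refine Polynomial.X_pow_dvd_iff.1 (?_ : Polynomial.X ^ (r + 1) ∣ _) r (Nat.lt_succ_self r)
  rw [← Ideal.mem_span_singleton]
  refine aeval_sub_mem _ (fun k => ?_) f
  rw [Fin.sum_univ_eq_sum_range (fun i : ℕ => (Polynomial.X ^ i : (Sym K)[X]) ^ (k : ℕ) *
    (((-1) ^ ((k : ℕ) + 1)) ^ i *
      Polynomial.C (powerPlethMap K k (perp ℚ (schur ℚ (column i)) g)))),
    ← Finset.sum_sdiff_eq_sub (Finset.range_mono (by omega))]
  refine Ideal.sum_mem _ fun i hi => ?_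
  simp only [Finset.mem_sdiff, Finset.mem_range] at hi
  refine Ideal.mul_mem_right _ _ ?_
  rw [Ideal.mem_span_singleton, ← pow_mul]
  have hk : i ≤ i * k := Nat.le_mul_of_pos_right i k.pos
  exact pow_dvd_pow _ (by omega)

/-- Homogeneity of $s_v$ extracts the powers of $t$, and the sign $((-1)^{k+1})^i$ on $p_k$ is the
effect of $\omega^i$. -/
theorem aeval_signed_schur (i : ℕ) (v : YoungDiagram) (g : Sym ℚ) :
    (aeval (fun k : ℕ+ => (Polynomial.X ^ i) ^ (k : ℕ) * (((-1) ^ ((k : ℕ) + 1)) ^ i *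
        Polynomial.C (powerPlethMap K k g))) (schur K v) : (Sym K)[X]) =
      Polynomial.X ^ (i * v.card) *
        Polynomial.C (pleth K ((omega K)^[i] (schur K v)) g) := by
  rw [aeval_pow_mul (isWeightedHomogeneous_schur K v), ← aeval_iterate_omega, ← pow_mul]
  congr 1
  have h : (aeval fun k => Polynomial.C (powerPlethMap K k g)) =
      (Polynomial.CAlgHom (R := K)).comp (aeval fun k => powerPlethMap K k g) := by
    ext k : 1; simp
  rw [h]; rfl

theorem isWeightedHomogeneous_prod_schur {n : ℕ} (v : Fin n → YoungDiagram) :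
    IsWeightedHomogeneous degWeight (∏ i, schur K (v i)) (∑ i, (v i).card) :=
  IsWeightedHomogeneous.prod _ _ _ fun i _ => isWeightedHomogeneous_schur K (v i)

theorem perp_column_pleth_schur (lam mu : YoungDiagram) (r : ℕ) :
    perp K (schur K (column r)) (pleth K (schur K lam) (schur ℚ mu)) =
      ∑ v ∈ sequences (min r (mu.colLen 0)) lam.card r,
        hall K (schur K lam) (∏ i, schur K (v i)) •
          ∏ i : Fin (min r (mu.colLen 0) + 1),
            pleth K ((omega K)^[(i : ℕ)] (schur K (v i)))
              (perp ℚ (schur ℚ (column (i : ℕ))) (schur ℚ mu)) := by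
  classical
  -- Any finite set of diagrams containing all those of size at most $|\lambda|$ would do.
  let S : Finset YoungDiagram := (Finset.range (lam.card + 1)).biUnion
    fun d => (finite_card_eq d).toFinset
  have hS : ∀ l : YoungDiagram, l ∈ S ↔ l.card ≤ lam.card := by
    intro l
    simp [S]
  rw [perp_column_pleth _ (natDegree_addDualVar_schur ℚ mu)]
  have key := aeval_sum_eq (fun i : Fin (min r (mu.colLen 0) + 1) =>
    (aeval (fun k : ℕ+ => (Polynomial.X ^ (i : ℕ)) ^ (k : ℕ) *
      (((-1) ^ ((k : ℕ) + 1)) ^ (i : ℕ) *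
        Polynomial.C (powerPlethMap K k (perp ℚ (schur ℚ (column i)) (schur ℚ mu))))) :
          Sym K →ₐ[K] (Sym K)[X]))
    (supportedOn_of_homogeneous (isWeightedHomogeneous_schur K lam) fun l => (hS l).2)
  simp only [aeval_X, aeval_signed_schur] at key
  rw [key, Polynomial.finsetSum_coeff]
  symm
  -- The two conditions on a sequence have different origins: $\sum i|\nu^{(i)}|=r$ from the power
  -- of $t$, and $\sum|\nu^{(i)}|=|\lambda|$ from the vanishing of the Hall form across degrees.
  have hterm : ∀ v : Fin (min r (mu.colLen 0) + 1) → YoungDiagram,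
      (hall K (schur K lam) (∏ i, schur K (v i)) • ∏ i : Fin (min r (mu.colLen 0) + 1),
        (Polynomial.X ^ ((i : ℕ) * (v i).card) *
          Polynomial.C (pleth K ((omega K)^[(i : ℕ)] (schur K (v i)))
            (perp ℚ (schur ℚ (column (i : ℕ))) (schur ℚ mu))))).coeff r =
      if v ∈ sequences (min r (mu.colLen 0)) lam.card r then
        hall K (schur K lam) (∏ i, schur K (v i)) •
          ∏ i : Fin (min r (mu.colLen 0) + 1),
            pleth K ((omega K)^[(i : ℕ)] (schur K (v i)))
              (perp ℚ (schur ℚ (column (i : ℕ))) (schur ℚ mu)) else 0 := by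
    intro v
    rw [Finset.prod_mul_distrib, Finset.prod_pow_eq_pow_sum, ← map_prod, Polynomial.coeff_smul,
      Polynomial.coeff_mul_C, Polynomial.coeff_X_pow]
    by_cases hd : ∑ i, (v i).card = lam.card
    · by_cases hr : ∑ i : Fin (min r (mu.colLen 0) + 1), (i : ℕ) * (v i).card = r
      · rw [if_pos hr.symm, if_pos (mem_sequences.2 ⟨hd, hr⟩), one_mul]
      · rw [if_neg (Ne.symm hr), if_neg (fun h => hr (mem_sequences.1 h).2), zero_mul, smul_zero]
    · rw [if_neg (fun h => hd (mem_sequences.1 h).1), hall_eq_zero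
        (isWeightedHomogeneous_schur K lam) (isWeightedHomogeneous_prod_schur v) (Ne.symm hd),
        zero_smul]
  rw [Finset.sum_congr rfl fun v _ => hterm v, Finset.sum_ite_mem,
    Finset.inter_eq_right.2]
  intro v hv
  rw [Fintype.mem_piFinset]
  intro i
  rw [hS, ← (mem_sequences.1 hv).1]
  exact Finset.single_le_sum (f := fun i => (v i).card) (fun _ _ => Nat.zero_le _)
    (Finset.mem_univ i)

end Plethysm

end SymFun

theorem mainTheorem4 (K : Type*) [CommRing K] [Algebra ℚ K] (lam mu : YoungDiagram)
    (r : ℕ) (hr : 0 < r) :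
    SymFun.perp K (SymFun.schur K (SymFun.column r))
        (SymFun.pleth K (SymFun.schur K lam) (SymFun.schur ℚ mu)) =
      ∑ v ∈ SymFun.sequences (min r (mu.colLen 0)) lam.card r,
        SymFun.hall K (SymFun.schur K lam) (∏ i, SymFun.schur K (v i)) •
          (SymFun.pleth K (SymFun.schur K (v 0)) (SymFun.schur ℚ mu) *
            ∏ i : Fin (min r (mu.colLen 0)),
              SymFun.pleth K ((SymFun.omega K)^[(i : ℕ) + 1] (SymFun.schur K (v i.succ)))
                (SymFun.perp ℚ (SymFun.schur ℚ (SymFun.column ((i : ℕ) + 1)))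
                  (SymFun.schur ℚ mu))) ∧
    ∀ (i : ℕ) (v : YoungDiagram), (SymFun.omega K)^[i] (SymFun.schur K v) =
      if Even i then SymFun.schur K v else SymFun.schur K v.transpose := by
  refine ⟨?_, SymFun.iterate_omega_schur K⟩
  rw [SymFun.perp_column_pleth_schur]
  refine Finset.sum_congr rfl fun v _ => ?_
  congr 1
  -- The factor $i=0$ is split off: $s_{1^0}=1$ acts as the identity, and $\omega^0$ is trivial.
  rw [Fin.prod_univ_succ, Fin.val_zero, SymFun.column_zero, SymFun.schur_bot, SymFun.perp_one]
  rfl
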